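/- Manifolds are smooth, finite-dimensional, Hausdorff and second countable; for a Poisson manifold $(N,\pi_N)$ write $\pi_N^\sharp:T^*N\to TN$, and let $\mathrm S_N(x)$ be the symplectic leaf through $x$: the orbit of $x$ under local flows of Hamiltonian vector fields $\pi_N^\sharp(\mathrm df)$ ($f$ smooth, possibly time-dependent), regarded as an immersed submanifold with the symplectic form $\omega_{\mathrm S_N(x)}$ for which the inclusion into $N$ is a Poisson map. A Poisson submersion $p:(\Sigma,\pi_\Sigma)\to(M,\pi_M)$ is a submersion that is a Poisson map (it is not required to be surjective); let $V=\ker p_*$ be its vertical bundle and $V^\circ\subset T^*\Sigma$ the annihilator of $V$. It is *coregular* if its fibres are coregular submanifolds, i.e. along each fibre $\pi_\Sigma^\sharp(V^\circ)$ is a smooth vector subbundle of $T\Sigma$ (restricted to the fibre) which meets $V$ trivially. It is *coupling* if its fibres are Poisson transversals, i.e. $T\Sigma=V\oplus\pi_\Sigma^\sharp(V^\circ)$. **Theorem.** Let $p:(\Sigma,\pi_\Sigma)\to(M,\pi_M)$ be a coregular Poisson submersion, and let $x\in\Sigma$. 1. The preimage $p^{-1}(\mathrm S_M(p(x)))$,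 with the topology of the fibre product $\mathrm S_M(p(x))\times_M\Sigma$, is an (immersed) Poisson submanifold of $(\Sigma,\pi_\Sigma)$: it carries a smooth structure and a Poisson structure $\pi_{p^{-1}\mathrm S_M(p(x))}$ for which the inclusion into $\Sigma$ is an injective immersion and a Poisson map. Moreover $p$ restricts to a coupling Poisson submersion $$\bigl(p^{-1}(\mathrm S_M(p(x))),\pi_{p^{-1}\mathrm S_M(p(x))}\bigr)\longrightarrow\bigl(\mathrm S_M(p(x)),\omega_{\mathrm S_M(p(x))}\bigr),$$ which is surjective if $p$ is. 2. $p$ maps $\mathrm S_\Sigma(x)$ into $\mathrm S_M(p(x))$, and restricts to a coupling Poisson submersion $$\bigl(\mathrm S_\Sigma(x),\omega_{\mathrm S_\Sigma(x)}\bigr)\longrightarrow\bigl(\mathrm S_M(p(x)),\omega_{\mathrm S_M(p(x))}\bigr)$$ (not necessarily surjective). -/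

import Mathlib

open Set
open scoped Manifold ContDiff

noncomputable section PoissonGeometry

/-- The differential `d f x ∈ T*_x M` of a real function on a manifold. -/
def dAt (E : Type*) [NormedAddCommGroup E] [NormedSpace ℝ E]
    {M : Type*} [TopologicalSpace M] [ChartedSpace E M] (f : M → ℝ) (x : M) :
    Module.Dual ℝ (TangentSpace 𝓘(ℝ, E) x) :=
  (mfderiv 𝓘(ℝ, E) 𝓘(ℝ, ℝ) f x : TangentSpace 𝓘(ℝ, E) x →L[ℝ] ℝ).toLinearMap

/-- The tangent map `T_x M → T_{p x} M'`, as a linear map. -/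
def tangentMapAt (E E' : Type*) [NormedAddCommGroup E] [NormedSpace ℝ E]
    [NormedAddCommGroup E'] [NormedSpace ℝ E']
    {M M' : Type*} [TopologicalSpace M] [ChartedSpace E M]
    [TopologicalSpace M'] [ChartedSpace E' M'] (p : M → M') (x : M) :
    TangentSpace 𝓘(ℝ, E) x →ₗ[ℝ] TangentSpace 𝓘(ℝ, E') (p x) :=
  (mfderiv 𝓘(ℝ, E) 𝓘(ℝ, E') p x).toLinearMap

/-- The function `{f, g} = dg (sharp (df))` attached to a family of maps
`sharp x : T*_x M → T_x M`. -/
def bracketOf {E : Type*} [NormedAddCommGroup E] [NormedSpace ℝ E]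
    {M : Type*} [TopologicalSpace M] [ChartedSpace E M]
    (sharp : ∀ x : M, Module.Dual ℝ (TangentSpace 𝓘(ℝ, E) x) →ₗ[ℝ] TangentSpace 𝓘(ℝ, E) x)
    (f g : M → ℝ) (x : M) : ℝ :=
  dAt E g x (sharp x (dAt E f x))

/-- A Poisson structure on a (smooth, Hausdorff, finite-dimensional, boundaryless) manifold `M`:
a smooth bivector field, given by the skew maps `sharp x = π^♯ : T*_x M → T_x M`, whose bracket
`{f, g} = π (df, dg)` satisfies the Jacobi identity (equivalently `[π, π] = 0`).
Smoothness of the bivector is smoothness of all its brackets. -/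
structure PoissonStructure (E : Type*) [NormedAddCommGroup E] [NormedSpace ℝ E]
    (M : Type*) [TopologicalSpace M] [ChartedSpace E M] where
  sharp : ∀ x : M, Module.Dual ℝ (TangentSpace 𝓘(ℝ, E) x) →ₗ[ℝ] TangentSpace 𝓘(ℝ, E) x
  skew : ∀ (x : M) (ξ η : Module.Dual ℝ (TangentSpace 𝓘(ℝ, E) x)),
    η (sharp x ξ) = -ξ (sharp x η)
  smooth : ∀ f g : M → ℝ, ContMDiff 𝓘(ℝ, E) 𝓘(ℝ, ℝ) ∞ f → ContMDiff 𝓘(ℝ, E) 𝓘(ℝ, ℝ) ∞ g →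
    ContMDiff 𝓘(ℝ, E) 𝓘(ℝ, ℝ) ∞ (bracketOf sharp f g)
  jacobi : ∀ f g h : M → ℝ, ContMDiff 𝓘(ℝ, E) 𝓘(ℝ, ℝ) ∞ f →
    ContMDiff 𝓘(ℝ, E) 𝓘(ℝ, ℝ) ∞ g → ContMDiff 𝓘(ℝ, E) 𝓘(ℝ, ℝ) ∞ h →
    ∀ x, bracketOf sharp f (bracketOf sharp g h) x + bracketOf sharp g (bracketOf sharp h f) x
      + bracketOf sharp h (bracketOf sharp f g) x = 0

namespace PoissonStructure

variable {E : Type*} [NormedAddCommGroup E] [NormedSpace ℝ E]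
  {M : Type*} [TopologicalSpace M] [ChartedSpace E M]
  {E' : Type*} [NormedAddCommGroup E'] [NormedSpace ℝ E']
  {M' : Type*} [TopologicalSpace M'] [ChartedSpace E' M']

/-- The Hamiltonian vector field `H_f = π^♯ (df)`. -/
def ham (π : PoissonStructure E M) (f : M → ℝ) (x : M) : TangentSpace 𝓘(ℝ, E) x :=
  π.sharp x (dAt E f x)

/-- `y` is reached from `x` along the local flow of the Hamiltonian vector field of a
(possibly time-dependent) smooth function. -/
def HamiltonianStep (π : PoissonStructure E M) (x y : M) : Prop :=
  ∃ f : ℝ → M → ℝ,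
    ContMDiff (𝓘(ℝ, ℝ).prod 𝓘(ℝ, E)) 𝓘(ℝ, ℝ) ∞ (fun q : ℝ × M => f q.1 q.2) ∧
    ∃ (γ : ℝ → M) (a b : ℝ),
      (∀ t ∈ Ioo a b, HasMFDerivAt 𝓘(ℝ, ℝ) 𝓘(ℝ, E) γ t
        ((1 : ℝ →L[ℝ] ℝ).smulRight (π.ham (f t) (γ t)))) ∧
      ∃ s ∈ Ioo a b, ∃ t ∈ Ioo a b, γ s = x ∧ γ t = y

/-- The set underlying the symplectic leaf through `x`: the orbit of `x` under Hamiltonian local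
flows, that is, under finite compositions of them. -/
def hamiltonianOrbit (π : PoissonStructure E M) (x : M) : Set M :=
  {y | Relation.ReflTransGen π.HamiltonianStep x y}

/-- The Poisson structure is symplectic: `π^♯` is invertible, i.e. `π` is the inverse of a
symplectic form `ω`, with `ω (π^♯ ξ, π^♯ η) = ± π (ξ, η)`. (The Jacobi identity for `π` is
closedness of `ω`.) -/
def IsSymplectic (π : PoissonStructure E M) : Prop :=
  ∀ x : M, Function.Bijective (π.sharp x)

/-- The conormal space `T°` of a subspace `T ⊆ T_x M`, mapped to `T_x M` by `π^♯`. -/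
def sharpConormal (π : PoissonStructure E M) {x : M}
    (T : Submodule ℝ (TangentSpace 𝓘(ℝ, E) x)) : Submodule ℝ (TangentSpace 𝓘(ℝ, E) x) :=
  T.dualAnnihilator.map (π.sharp x)

/-- `p` is a smooth map whose tangent maps send `π` to `π'`:
`p_* ∘ π^♯ ∘ p^* = π'^♯`; equivalently `{f ∘ p, g ∘ p} = {f, g} ∘ p`. -/
structure IsPoissonMap (π : PoissonStructure E M) (π' : PoissonStructure E' M')
    (p : M → M') : Prop where
  contMDiff : ContMDiff 𝓘(ℝ, E) 𝓘(ℝ, E') ∞ p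
  map_sharp : ∀ (x : M) (ξ : Module.Dual ℝ (TangentSpace 𝓘(ℝ, E') (p x))),
    tangentMapAt E E' p x (π.sharp x (ξ ∘ₗ tangentMapAt E E' p x)) = π'.sharp (p x) ξ

/-- A Poisson submersion: a Poisson map with surjective differentials.
(Surjectivity of the map itself is not included.) -/
structure IsPoissonSubmersion (π : PoissonStructure E M) (π' : PoissonStructure E' M')
    (p : M → M') : Prop extends IsPoissonMap π π' p where
  surjective_tangentMap : ∀ x : M, Function.Surjective (tangentMapAt E E' p x)

/-- `(M, π)` is a Poisson submanifold of `(M', π')` via the injective immersion `i`: `π'` is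
tangent to it, and restricts to `π`. -/
structure IsPoissonSubmanifold (π : PoissonStructure E M) (π' : PoissonStructure E' M')
    (i : M → M') : Prop extends IsPoissonMap π π' i where
  injective : Function.Injective i
  injective_tangentMap : ∀ x : M, Function.Injective (tangentMapAt E E' i x)

/-- `(S, πS)`, with the inclusion `j : S → M`, is the symplectic leaf of `(M, π)` through `x`:
an immersed symplectic manifold whose underlying set is the orbit of `x` under Hamiltonian local
flows, with the symplectic structure for which the inclusion is Poisson. In particular
`j_* (T_s S) = π^♯ (T*_{j s} M)`. These conditions determine the manifold `S` and its
symplectic structure up to a unique isomorphism over `M`. -/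
structure IsSymplecticLeaf (π : PoissonStructure E M) (x : M)
    {F : Type*} [NormedAddCommGroup F] [NormedSpace ℝ F]
    {S : Type*} [TopologicalSpace S] [ChartedSpace F S]
    (πS : PoissonStructure F S) (j : S → M) : Prop extends IsPoissonSubmanifold πS π j where
  symplectic : πS.IsSymplectic
  range_eq : range j = π.hamiltonianOrbit x

end PoissonStructure

/-- A family of subspaces `D x ⊆ T_x M`, for `x` in an embedded submanifold `X ⊆ M`, is a (smooth)
vector subbundle of `TM|_X`: locally, it has a smooth frame (written here with an extension of the
frame to an open subset of `M`). -/
def IsSubbundleAlong {E : Type*} [NormedAddCommGroup E] [NormedSpace ℝ E]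
    {M : Type*} [TopologicalSpace M] [ChartedSpace E M] [IsManifold 𝓘(ℝ, E) ∞ M] (X : Set M)
    (D : ∀ x : M, Submodule ℝ (TangentSpace 𝓘(ℝ, E) x)) : Prop :=
  ∀ x₀ ∈ X, ∃ (U : Set M) (k : ℕ) (Z : Fin k → ∀ x : M, TangentSpace 𝓘(ℝ, E) x),
    IsOpen U ∧ x₀ ∈ U ∧
    (∀ i, ContMDiffOn 𝓘(ℝ, E) 𝓘(ℝ, E).tangent ∞
      (fun x => (⟨x, Z i x⟩ : TangentBundle 𝓘(ℝ, E) M)) U) ∧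
    ∀ x ∈ X ∩ U, LinearIndependent ℝ (fun i => Z i x) ∧
      Submodule.span ℝ (range fun i => Z i x) = D x

namespace PoissonStructure

variable {E : Type*} [NormedAddCommGroup E] [NormedSpace ℝ E]
  {M : Type*} [TopologicalSpace M] [ChartedSpace E M]
  {E' : Type*} [NormedAddCommGroup E'] [NormedSpace ℝ E']
  {M' : Type*} [TopologicalSpace M'] [ChartedSpace E' M']

/-- An embedded submanifold `X ⊆ M` with tangent spaces `T x` (for `x ∈ X`) is coregular:
`π^♯ (N* X)` is a vector subbundle of `TM|_X` which meets `TX` trivially. -/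
def IsCoregularAlong [IsManifold 𝓘(ℝ, E) ∞ M] (π : PoissonStructure E M) (X : Set M)
    (T : ∀ x : M, Submodule ℝ (TangentSpace 𝓘(ℝ, E) x)) : Prop :=
  IsSubbundleAlong X (fun x => π.sharpConormal (T x)) ∧
    ∀ x ∈ X, Disjoint (T x) (π.sharpConormal (T x))

/-- An embedded submanifold `X ⊆ M` with tangent spaces `T x` (for `x ∈ X`) is a Poisson
transversal: it meets the leaves transversally in symplectic submanifolds, that is,
`TM|_X = TX ⊕ π^♯ (N* X)`. -/
def IsPoissonTransversalAlong (π : PoissonStructure E M) (X : Set M)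
    (T : ∀ x : M, Submodule ℝ (TangentSpace 𝓘(ℝ, E) x)) : Prop :=
  ∀ x ∈ X, IsCompl (T x) (π.sharpConormal (T x))

/-- A coregular Poisson submersion: a Poisson submersion whose fibres (which have the tangent
spaces `V = ker p_*`) are coregular submanifolds. -/
structure IsCoregularPoissonSubmersion [IsManifold 𝓘(ℝ, E) ∞ M]
    (π : PoissonStructure E M) (π' : PoissonStructure E' M') (p : M → M') : Prop extends IsPoissonSubmersion π π' p where
  coregular : ∀ y : M',
    π.IsCoregularAlong (p ⁻¹' {y}) (fun x => LinearMap.ker (tangentMapAt E E' p x))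

/-- A coupling Poisson submersion: a Poisson submersion whose fibres are Poisson transversals. -/
structure IsCouplingPoissonSubmersion (π : PoissonStructure E M) (π' : PoissonStructure E' M')
    (p : M → M') : Prop extends IsPoissonSubmersion π π' p where
  coupling : ∀ y : M',
    π.IsPoissonTransversalAlong (p ⁻¹' {y}) (fun x => LinearMap.ker (tangentMapAt E E' p x))

end PoissonStructure

end PoissonGeometry

/-! Write `V = ker p_*`. One pointwise fact drives both parts: if `V` meets `π_X^♯(V°)` trivially,
then `p_*` maps `im π_X^♯` into `im π_M^♯` (`mem_range_sharp_of_disjoint`). Also, any Poisson map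
`q` to a symplectic manifold is automatically a coupling submersion: `q_* π^♯ q^*` is invertible, so
`π^♯(im q^*)` is a complement of `ker q_*` (`isCompl_ker_map_sharp`). A smooth map into the leaf `S`
is Poisson as soon as its composite with the Poisson immersion `j` is (`IsPoissonMap.of_comp_eq`).
So it remains to build the manifold, its Poisson structure and the smooth maps.

For the preimage of the leaf, the fibre product `S ×_M X` is a manifold whose tangent space in `X`
is `p_*⁻¹(TS)`. Since `TS = im π_M^♯`, the pointwise fact says that this contains `im π_X^♯`, and a
Poisson tensor tangent to an immersed submanifold restricts to it (`exists_restriction`).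

For the leaf of `X`, the first obstacle is that `p` must map orbits to orbits. A Hamiltonian curve
projects to a curve tangent to `im π_M^♯`, but covectors generating it can be chosen smoothly only
if the rank of `π_M` is under control. Along curves already known to be Hamiltonian it is, because
the linearized flow transports the tensor (`eventually_eq_comp`).
`exists_hamiltonian_of_integralCurve` breaks the circle: it solves a modified equation whose
solution projects to a Hamiltonian curve by construction, and then identifies that solution with the
given curve by uniqueness.

The second obstacle is that the map into `S` must be smooth for the leaf topology. Instead of
Frobenius charts, `exists_lift_of_tangent` compares a map tangent to `im π_M^♯` with its retraction
onto a piece of the leaf: the derivative of the difference is bounded by the difference, so Grönwall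
makes it vanish. -/

section SymplecticLeaves

open Filter Topology

set_option maxSynthPendingDepth 3

/-! ### Time-dependent differential equations and Grönwall. -/

section ODE

variable {E : Type*} [NormedAddCommGroup E] [NormedSpace ℝ E]

/-- Local existence for a time-dependent `C^1` vector field. -/
theorem exists_integralCurve_of_contDiffAt [CompleteSpace E] {v : ℝ × E → E} {t₀ : ℝ} {x₀ : E}
    (hv : ContDiffAt ℝ 1 v (t₀, x₀)) :
    ∃ z : ℝ → E, z t₀ = x₀ ∧ ∀ᶠ t in 𝓝 t₀, HasDerivAt z (v (t, z t)) t := by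
  -- A clock of speed 1 makes the field autonomous; `hfst` identifies the clock with `t`.
  have hw : ContDiffAt ℝ 1 (fun q : ℝ × E => ((1 : ℝ), v q)) (t₀, x₀) :=
    contDiffAt_const.prodMk hv
  obtain ⟨α, hα₀, ε, hε, hα⟩ :=
    hw.exists_forall_mem_closedBall_exists_eq_forall_mem_Ioo_hasDerivAt₀ t₀
  have ht₀ : t₀ ∈ Ioo (t₀ - ε) (t₀ + ε) := ⟨by linarith, by linarith⟩
  have hfst : EqOn (fun t => (α t).1) id (Ioo (t₀ - ε) (t₀ + ε)) := by
    refine ODE_solution_unique_of_mem_Ioo (v := fun _ _ => (1 : ℝ)) (s := fun _ => univ) (K := 0)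
      (fun t _ => LipschitzWith.const' (1 : ℝ) |>.lipschitzOnWith) ht₀
      (fun t ht => ⟨(hα t ht).fst, mem_univ _⟩)
      (fun t _ => ⟨hasDerivAt_id t, mem_univ _⟩) (by simp [hα₀])
  refine ⟨fun t => (α t).2, by simp [hα₀], ?_⟩
  filter_upwards [Ioo_mem_nhds ht₀.1 ht₀.2] with t ht
  have h1 := (hα t ht).snd
  have h2 : (t, (α t).2) = α t := Prod.ext (hfst ht).symm rfl
  rwa [h2]

/-- Local uniqueness for a time-dependent `C^1` vector field. -/
theorem integralCurve_eventuallyEq_of_contDiffAt {v : ℝ × E → E} {t₀ : ℝ} {z₁ z₂ : ℝ → E}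
    (hv : ContDiffAt ℝ 1 v (t₀, z₁ t₀))
    (h₁ : ∀ᶠ t in 𝓝 t₀, HasDerivAt z₁ (v (t, z₁ t)) t)
    (h₂ : ∀ᶠ t in 𝓝 t₀, HasDerivAt z₂ (v (t, z₂ t)) t) (h : z₁ t₀ = z₂ t₀) :
    z₁ =ᶠ[𝓝 t₀] z₂ := by
  obtain ⟨K, s, hs, hK⟩ := hv.exists_lipschitzOnWith
  have c₁ : ContinuousAt (fun t => (t, z₁ t)) t₀ :=
    continuousAt_id.prodMk h₁.self_of_nhds.continuousAt
  have c₂ : ContinuousAt (fun t => (t, z₂ t)) t₀ :=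
    continuousAt_id.prodMk h₂.self_of_nhds.continuousAt
  refine ODE_solution_unique_of_eventually (v := fun t x => v (t, x)) (s := fun t => {x | (t, x) ∈ s})
    (K := K) (Eventually.of_forall fun t => ?_) (h₁.and (c₁ hs)) (h₂.and (c₂ ?_)) h
  · intro x hx y hy
    refine (hK hx hy).trans_eq ?_
    simp [Prod.edist_eq]
  · show s ∈ 𝓝 (t₀, z₂ t₀)
    exact h ▸ hs

/-- Integral curves of smooth time-dependent vector fields are smooth. -/
theorem contDiffOn_of_hasDerivAt {v : ℝ × E → E} [CompleteSpace E] {U : Set (ℝ × E)} (hU : IsOpen U)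
    (hv : ContDiffOn ℝ ∞ v U) {z : ℝ → E} {a b : ℝ}
    (hz : ∀ t ∈ Ioo a b, HasDerivAt z (v (t, z t)) t) (hzU : ∀ t ∈ Ioo a b, (t, z t) ∈ U) :
    ContDiffOn ℝ ∞ z (Ioo a b) := by
  intro t₀ ht₀
  obtain ⟨V, hV, W, hW, hVW⟩ := mem_nhds_prod_iff.1 (hU.mem_nhds (hzU t₀ ht₀))
  have h1 : ∀ᶠ t in 𝓝 t₀, t ∈ V ∧ z t ∈ W ∧ t ∈ Ioo a b :=
    Filter.Eventually.and hV (Filter.Eventually.and ((hz t₀ ht₀).continuousAt hW)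
      (Ioo_mem_nhds ht₀.1 ht₀.2))
  obtain ⟨ε, hε, hb⟩ := Metric.nhds_basis_closedBall.eventually_iff.1 h1
  rw [Real.closedBall_eq_Icc] at hb
  have := ODE.contDiffOn_enat_Icc_of_hasDerivWithinAt (f := fun t x => v (t, x)) (α := z) (n := ⊤)
    (tmin := t₀ - ε) (tmax := t₀ + ε) (u := W)
    (hv.mono fun q hq => hVW ⟨(hb hq.1).1, hq.2⟩)
    (fun t ht => (hz t (hb ht).2.2).hasDerivWithinAt) (fun t ht => (hb ht).2.1)
  exact (this.contDiffAt (Icc_mem_nhds (by linarith) (by linarith))).contDiffWithinAt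

/-- Grönwall on a convex set: a map with `‖D'‖ ≤ C ‖D‖` which vanishes somewhere vanishes. -/
theorem eq_zero_of_norm_fderiv_le {F : Type*} [NormedAddCommGroup F] [NormedSpace ℝ F]
    {D : E → F} {D' : E → E →L[ℝ] F} {s : Set E} (hs : Convex ℝ s) {C : ℝ}
    (hD : ∀ x ∈ s, HasFDerivAt D (D' x) x) (hC : ∀ x ∈ s, ‖D' x‖ ≤ C * ‖D x‖)
    {x₀ x : E} (hx₀ : x₀ ∈ s) (hx : x ∈ s) (h₀ : D x₀ = 0) : D x = 0 := by
  set c : ℝ → E := fun τ => x₀ + τ • (x - x₀)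
  have hc : ∀ τ ∈ Icc (0 : ℝ) 1, c τ ∈ s := fun τ hτ => hs.add_smul_sub_mem hx₀ hx hτ
  have hc' : ∀ τ, HasDerivAt c (x - x₀) τ := fun τ => by
    simpa [c] using ((hasDerivAt_id τ).smul_const (x - x₀)).const_add x₀
  have hDc : ∀ τ ∈ Icc (0 : ℝ) 1, HasDerivAt (D ∘ c) (D' (c τ) (x - x₀)) τ := fun τ hτ =>
    (hD _ (hc τ hτ)).comp_hasDerivAt τ (hc' τ)
  have := eq_zero_of_abs_deriv_le_mul_abs_self_of_eq_zero_right (f := D ∘ c) (K := C * ‖x - x₀‖)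
    (a := 0) (b := 1) (fun τ hτ => (hDc τ hτ).continuousAt.continuousWithinAt)
    (fun τ hτ => (hDc τ (Ico_subset_Icc_self hτ)).hasDerivWithinAt) (by simp [c, h₀]) (fun τ hτ => by
      refine ((D' (c τ)).le_opNorm _).trans ?_
      rw [mul_right_comm]
      gcongr
      exact hC _ (hc τ (Ico_subset_Icc_self hτ))) 1 (by simp)
  simpa [c] using this

end ODE

/-! ### Poisson tensors in coordinates and their rank along Hamiltonian curves. -/

section LocalPoisson

variable {E : Type*} [NormedAddCommGroup E] [NormedSpace ℝ E]

/-- A Poisson tensor on an open subset `O` of a normed space, as the map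
`P u : E* → E` at the points `u ∈ O`. -/
structure IsLocalPoisson (O : Set E) (P : E → (E →L[ℝ] ℝ) →L[ℝ] E) : Prop where
  isOpen : IsOpen O
  contDiffOn : ContDiffOn ℝ ∞ P O
  skew : ∀ u ∈ O, ∀ ξ η : E →L[ℝ] ℝ, η (P u ξ) = -ξ (P u η)
  jacobi : ∀ u ∈ O, ∀ α β γ : E →L[ℝ] ℝ, γ (fderiv ℝ P u (P u α) β) +
    α (fderiv ℝ P u (P u β) γ) + β (fderiv ℝ P u (P u γ) α) = 0

namespace IsLocalPoisson

variable {O : Set E} {P : E → (E →L[ℝ] ℝ) →L[ℝ] E} (h : IsLocalPoisson O P)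
include h

theorem hasFDerivAt {u : E} (hu : u ∈ O) : HasFDerivAt P (fderiv ℝ P u) u :=
  ((h.contDiffOn.contDiffAt (h.isOpen.mem_nhds hu)).differentiableAt (by simp)).hasFDerivAt

theorem fderiv_skew {u : E} (hu : u ∈ O) (v : E) (ξ η : E →L[ℝ] ℝ) :
    η (fderiv ℝ P u v ξ) = -ξ (fderiv ℝ P u v η) := by
  have key : ∀ ξ η : E →L[ℝ] ℝ,
      HasFDerivAt (fun w => η (P w ξ)) (η.comp ((fderiv ℝ P u).flip ξ)) u := fun ξ η => by
    have := (h.hasFDerivAt hu).clm_apply (hasFDerivAt_const ξ u)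
    have := η.hasFDerivAt.comp u this
    exact this.congr_fderiv (by ext; simp)
  have h1 := key ξ η
  have h2 := (key η ξ).neg
  have h3 : (fun w => η (P w ξ)) =ᶠ[𝓝 u] -(fun w => ξ (P w η)) := by
    filter_upwards [h.isOpen.mem_nhds hu] with w hw using h.skew w hw ξ η
  have := (h1.unique (h2.congr_of_eventuallyEq h3))
  simpa using congrArg (fun A => A v) this

/-- The flow of a Hamiltonian vector field with linear Hamiltonians transports the Poisson tensor. -/
theorem eventually_eq_comp [FiniteDimensional ℝ E] {m : ℝ → E} {α : ℝ → E →L[ℝ] ℝ} {t₀ : ℝ} (hm₀ : m t₀ ∈ O)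
    (hm : ContDiffAt ℝ 1 m t₀) (hα : ContDiffAt ℝ 1 α t₀)
    (hmα : ∀ᶠ t in 𝓝 t₀, HasDerivAt m (P (m t) (α t)) t) :
    ∀ᶠ t in 𝓝 t₀, ∃ (A : E →L[ℝ] E) (B : (E →L[ℝ] ℝ) →L[ℝ] (E →L[ℝ] ℝ)),
      P (m t) = A ∘L P (m t₀) ∘L B := by
  -- `Q t` linearizes the field `u ↦ P u (α t)` at `m t`, and `S A` is the transpose of `A`. By
  -- Jacobi and skewness, `P (m t)` solves the linear equation `Y' = Q Y + Y S(Q)` (`h1`). If `Ψ' =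
  -- Q Ψ` and `Ψ t₀ = id`, then `Ψ ∘ P (m t₀) ∘ S Ψ` solves it too (`h2`), with the same initial
  -- value.
  set Q : ℝ → E →L[ℝ] E := fun t => (fderiv ℝ P (m t)).flip (α t) with hQ
  set S : (E →L[ℝ] E) →L[ℝ] (E →L[ℝ] ℝ) →L[ℝ] (E →L[ℝ] ℝ) :=
    (ContinuousLinearMap.compL ℝ E E ℝ).flip with hS
  have hPm : ContDiffAt ℝ 1 (fun t => fderiv ℝ P (m t)) t₀ := by
    have : ContDiffAt ℝ 1 (fderiv ℝ P) (m t₀) :=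
      (h.contDiffOn.contDiffAt (h.isOpen.mem_nhds hm₀)).fderiv_right (m := 1)
        (by rw [one_add_one_eq_two]; exact WithTop.coe_le_coe.2 le_top)
    exact this.comp t₀ hm
  have hQs : ContDiffAt ℝ 1 Q t₀ :=
    ((ContinuousLinearMap.flipₗᵢ ℝ E (E →L[ℝ] ℝ) E).contDiff.contDiffAt.comp t₀ hPm).clm_apply hα
  have hQs' : ∀ {G : Type _} [NormedAddCommGroup G] [NormedSpace ℝ G] (x : G),
      ContDiffAt ℝ 1 (fun q : ℝ × G => Q q.1) (t₀, x) := fun x =>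
    hQs.comp (t₀, x) contDiffAt_fst
  obtain ⟨Ψ, hΨ₀, hΨ⟩ := exists_integralCurve_of_contDiffAt (E := E →L[ℝ] E)
    (v := fun q => (Q q.1).comp q.2) (t₀ := t₀) (x₀ := ContinuousLinearMap.id ℝ E)
    ((hQs' _).clm_comp contDiffAt_snd)
  have hmO : ∀ᶠ t in 𝓝 t₀, m t ∈ O := hm.continuousAt (h.isOpen.mem_nhds hm₀)
  have h1 : ∀ᶠ t in 𝓝 t₀, HasDerivAt (fun t => P (m t))
      ((Q t).comp (P (m t)) + (P (m t)).comp (S (Q t))) t := by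
    filter_upwards [hmO, hmα] with t ht ht'
    have hd := (h.hasFDerivAt ht).comp_hasDerivAt t ht'
    refine hd.congr_deriv ?_
    ext β
    rw [← sub_eq_zero]
    refine SeparatingDual.eq_zero_of_forall_dual_eq_zero (R := ℝ) fun γ => ?_
    have e1 := h.jacobi _ ht (α t) β γ
    have e2 := h.fderiv_skew ht (P (m t) β) (α t) γ
    have e3 := h.skew _ ht γ (S (Q t) β)
    have e4 := h.skew _ ht (S (Q t) β) γ
    simp only [hS, ContinuousLinearMap.flip_apply, ContinuousLinearMap.compL_apply,
      ContinuousLinearMap.comp_apply, hQ, map_sub, map_add, add_apply] at *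
    linarith
  have h2 : ∀ᶠ t in 𝓝 t₀, HasDerivAt (fun t => (Ψ t).comp ((P (m t₀)).comp (S (Ψ t))))
      ((Q t).comp ((Ψ t).comp ((P (m t₀)).comp (S (Ψ t)))) +
        ((Ψ t).comp ((P (m t₀)).comp (S (Ψ t)))).comp (S (Q t))) t := by
    filter_upwards [hΨ] with t ht
    have hSd := S.hasFDerivAt.comp_hasDerivAt t ht
    have := ht.clm_comp ((hasDerivAt_const t (P (m t₀))).clm_comp hSd)
    refine this.congr_deriv ?_
    ext β
    simp [hS, ContinuousLinearMap.comp_assoc]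
  have := integralCurve_eventuallyEq_of_contDiffAt
    (v := fun q : ℝ × ((E →L[ℝ] ℝ) →L[ℝ] E) => (Q q.1).comp q.2 + q.2.comp (S (Q q.1)))
    (((hQs' _).clm_comp contDiffAt_snd).add
      (contDiffAt_snd.clm_comp (S.contDiff.contDiffAt.comp _ (hQs' _)))) h1 h2
    (by ext; simp [hΨ₀, hS])
  filter_upwards [this] with t ht using ⟨Ψ t, S (Ψ t), ht⟩

/-- Since `P (m t)` factors through `P (m t₀)`, the rank cannot jump up. This is exactly the
condition under which `exists_smooth_rightInverse_on_range` can be used at `m t`. -/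
theorem eventually_finrank_le [FiniteDimensional ℝ E] {m : ℝ → E} {α : ℝ → E →L[ℝ] ℝ} {t₀ : ℝ} (hm₀ : m t₀ ∈ O)
    (hm : ContDiffAt ℝ 1 m t₀) (hα : ContDiffAt ℝ 1 α t₀)
    (hmα : ∀ᶠ t in 𝓝 t₀, HasDerivAt m (P (m t) (α t)) t) :
    ∀ᶠ t in 𝓝 t₀, Module.finrank ℝ (P (m t)).toLinearMap.range ≤
      Module.finrank ℝ (P (m t₀)).toLinearMap.range := by
  filter_upwards [h.eventually_eq_comp hm₀ hm hα hmα] with t ⟨A, B, hAB⟩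
  have : (P (m t)).toLinearMap.range ≤ (P (m t₀)).toLinearMap.range.map A.toLinearMap := by
    rintro _ ⟨ξ, rfl⟩
    exact ⟨P (m t₀) (B ξ), ⟨B ξ, rfl⟩, by simp [hAB]⟩
  exact (Submodule.finrank_mono this).trans (Submodule.finrank_map_le _ _)

end IsLocalPoisson

/-- Near a point of rank `n`, a smooth family of maps `P u : F → E` has a smooth family of
right inverses on the image, at all points of rank at most `n`. -/
theorem exists_smooth_rightInverse_on_range {F : Type*} [NormedAddCommGroup F] [NormedSpace ℝ F]
    [FiniteDimensional ℝ E] [FiniteDimensional ℝ F] {O : Set E} (hO : IsOpen O) {P : E → F →L[ℝ] E}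
    (hP : ContDiffOn ℝ ∞ P O) {u₀ : E} (hu₀ : u₀ ∈ O) :
    ∃ (O' : Set E) (θ : E → E →L[ℝ] F), IsOpen O' ∧ u₀ ∈ O' ∧ O' ⊆ O ∧ ContDiffOn ℝ ∞ θ O' ∧
      ∀ u ∈ O', Module.finrank ℝ (P u).toLinearMap.range ≤
        Module.finrank ℝ (P u₀).toLinearMap.range → ∀ v ∈ (P u).toLinearMap.range,
          P u (θ u v) = v := by
  set R := (P u₀).toLinearMap.range with hR
  obtain ⟨L', hL'⟩ := LinearMap.exists_leftInverse_of_injective R.subtype (by simp)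
  obtain ⟨K', hK'⟩ := LinearMap.exists_rightInverse_of_surjective (P u₀).toLinearMap.rangeRestrict
    (LinearMap.range_rangeRestrict _)
  set L : E →L[ℝ] R := LinearMap.toContinuousLinearMap L'
  set K : R →L[ℝ] F := LinearMap.toContinuousLinearMap K'
  -- The compression of `P u` to the range at `u₀`; it is the identity at `u₀`, hence invertible
  -- nearby, and the right inverse is `K G⁻¹ L`.
  set G : E → R →L[ℝ] R := fun u => L ∘L P u ∘L K with hG
  have hGs : ContDiffOn ℝ ∞ G O := contDiffOn_const.clm_comp (hP.clm_comp contDiffOn_const)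
  have hG₀ : G u₀ = 1 := by
    ext1 r
    have h1 : (P u₀) (K' r) = (r : E) := by
      simpa using congrArg Subtype.val (LinearMap.congr_fun hK' r)
    have h2 : L' (r : E) = r := LinearMap.congr_fun hL' r
    simp [hG, L, K, h1, h2]
  set O' : Set E := O ∩ G ⁻¹' {A | IsUnit A} with hO'
  have hO'o : IsOpen O' := hGs.continuousOn.isOpen_inter_preimage hO Units.isOpen
  refine ⟨O', fun u => K ∘L Ring.inverse (G u) ∘L L, hO'o, ⟨hu₀, by simp [hG₀]⟩,
    inter_subset_left, ?_, ?_⟩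
  · refine contDiffOn_const.clm_comp (ContDiffOn.clm_comp ?_ contDiffOn_const)
    intro u hu
    obtain ⟨A, hA⟩ := hu.2
    have := contDiffAt_ringInverse ℝ (n := ∞) A
    rw [hA] at this
    exact (this.comp u (hGs.contDiffAt (hO.mem_nhds hu.1))).contDiffWithinAt
  · rintro u ⟨-, hu⟩ hr v hv
    have hGinj : Function.Injective (G u) := by
      refine Function.LeftInverse.injective (g := fun x => (Ring.inverse (G u)) x) fun x => ?_
      exact congrArg (fun A : R →L[ℝ] R => A x) (Ring.inverse_mul_cancel (G u) hu)
    set T : R →ₗ[ℝ] E := (P u).toLinearMap ∘ₗ K.toLinearMap with hT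
    have hTinj : Function.Injective T := fun x y hxy => hGinj (congrArg L hxy)
    have hle : T.range ≤ (P u).toLinearMap.range := LinearMap.range_comp_le_range _ _
    -- `P u ∘ K` is injective, so its range already has the dimension of `R`; the rank bound leaves
    -- no room for a larger range of `P u`.
    have heq : T.range = (P u).toLinearMap.range := by
      refine Submodule.eq_of_le_of_finrank_le hle ?_
      rwa [LinearMap.finrank_range_of_inj hTinj]
    rw [← heq] at hv
    obtain ⟨w, rfl⟩ := hv
    have : Ring.inverse (G u) (L (T w)) = w :=
      congrArg (fun A : R →L[ℝ] R => A w) (Ring.inverse_mul_cancel (G u) hu)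
    simp only [ContinuousLinearMap.comp_apply, this]
    rfl

end LocalPoisson

/-! ### Submersion coordinates and left inverses of immersions. -/

section InverseFunction

variable {E F : Type*} [NormedAddCommGroup E] [NormedSpace ℝ E]
  [NormedAddCommGroup F] [NormedSpace ℝ F]

/-- The inverse function theorem, with a smooth inverse on the whole target. -/
theorem exists_openPartialHomeomorph_of_contDiffOn [CompleteSpace E] {f : E → F} {U : Set E}
    (hU : IsOpen U) (hf : ContDiffOn ℝ ∞ f U) {u₀ : E} (hu₀ : u₀ ∈ U) {A : E ≃L[ℝ] F}
    (hA : HasFDerivAt f (A : E →L[ℝ] F) u₀) :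
    ∃ Φ : OpenPartialHomeomorph E F, u₀ ∈ Φ.source ∧ Φ.source ⊆ U ∧ (∀ u, Φ u = f u) ∧
      ContDiffOn ℝ ∞ Φ.symm Φ.target := by
  have hfa := hf.contDiffAt (hU.mem_nhds hu₀)
  set Φ₀ := hfa.toOpenPartialHomeomorph f hA (by simp)
  have hΦ₀ : ∀ u, Φ₀ u = f u := fun u => rfl
  set s : Set E := U ∩ (fderiv ℝ f) ⁻¹' range ((↑) : (E ≃L[ℝ] F) → E →L[ℝ] F)
  -- Restricting to the points with invertible derivative makes the inverse smooth on the whole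
  -- target, not only at the image of `u₀`.
  have hs : IsOpen s :=
    (hf.continuousOn_fderiv_of_isOpen hU (by simp)).isOpen_inter_preimage hU
      (ContinuousLinearEquiv.isOpen (𝕜 := ℝ) (E := E) (F := F))
  refine ⟨Φ₀.restrOpen s hs, ⟨hfa.mem_toOpenPartialHomeomorph_source hA (by simp), hu₀, A,
    hA.fderiv.symm⟩, fun u hu => hu.2.1, fun u => rfl, fun y hy => ?_⟩
  have hx := (Φ₀.restrOpen s hs).map_target hy
  obtain ⟨B, hB⟩ := hx.2.2
  have hfx := hf.contDiffAt (hU.mem_nhds hx.2.1)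
  refine (OpenPartialHomeomorph.contDiffAt_symm _ hy (f₀' := B) ?_ hfx).contDiffWithinAt
  rw [hB]
  exact (hfx.differentiableAt (by simp)).hasFDerivAt

/-- The derivative of a smooth inverse of a partial homeomorphism. -/
theorem OpenPartialHomeomorph.fderiv_symm_apply_of_hasFDerivAt (Φ : OpenPartialHomeomorph E F)
    (hΦ : ContDiffOn ℝ ∞ Φ.symm Φ.target) {u : E} (hu : u ∈ Φ.source) {A : E →L[ℝ] F}
    (hA : HasFDerivAt Φ A u) (v : E) : fderiv ℝ Φ.symm (Φ u) (A v) = v := by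
  have h1 := ((hΦ.contDiffAt (Φ.open_target.mem_nhds (Φ.map_source hu))).differentiableAt
    (by simp)).hasFDerivAt.comp u hA
  have h2 : HasFDerivAt (Φ.symm ∘ Φ) (ContinuousLinearMap.id ℝ E) u := by
    refine (hasFDerivAt_id u).congr_of_eventuallyEq ?_
    filter_upwards [Φ.open_source.mem_nhds hu] with x hx using Φ.left_inv hx
  exact congrArg (fun B : E →L[ℝ] E => B v) (h1.unique h2)

/-- A surjective linear map is a projection, in suitable coordinates. -/
theorem ContinuousLinearMap.exists_prod_equiv_of_surjective [FiniteDimensional ℝ E]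
    {D : E →L[ℝ] F} (hD : Function.Surjective D) :
    ∃ (W : E →L[ℝ] D.toLinearMap.ker) (A : E ≃L[ℝ] F × D.toLinearMap.ker), ∀ x, A x = (D x, W x) := by
  obtain ⟨W', hW'⟩ := LinearMap.exists_leftInverse_of_injective D.toLinearMap.ker.subtype (by simp)
  have hW : ∀ k : D.toLinearMap.ker, W' (k : E) = k := fun k => LinearMap.congr_fun hW' k
  set W : E →L[ℝ] D.toLinearMap.ker := LinearMap.toContinuousLinearMap W'
  have hinj : Function.Injective (D.toLinearMap.prod W') := by
    refine (injective_iff_map_eq_zero _).2 fun x hx => ?_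
    have h1 : D x = 0 := congrArg Prod.fst hx
    have h2 : W' x = 0 := congrArg Prod.snd hx
    have h3 := hW ⟨x, h1⟩
    rw [h2] at h3
    exact (congrArg Subtype.val h3).symm
  have hsurj : Function.Surjective (D.toLinearMap.prod W') := by
    rintro ⟨a, k⟩
    obtain ⟨x, rfl⟩ := hD a
    refine ⟨x + ((k - W' x : D.toLinearMap.ker) : E), ?_⟩
    ext1
    · simp
    · show W' (x + ((k - W' x : D.toLinearMap.ker) : E)) = k
      rw [map_add, hW]; abel
  have : FiniteDimensional ℝ F := Module.Finite.of_surjective D.toLinearMap hD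
  exact ⟨W, (LinearEquiv.ofBijective _ ⟨hinj, hsurj⟩).toContinuousLinearEquiv, fun x => rfl⟩

/-- Submersion coordinates. -/
theorem exists_submersion_coordinates [FiniteDimensional ℝ E] {g : E → F} {U : Set E}
    (hU : IsOpen U) (hg : ContDiffOn ℝ ∞ g U) {u₀ : E} (hu₀ : u₀ ∈ U)
    (hs : Function.Surjective (fderiv ℝ g u₀)) :
    ∃ (W : E →L[ℝ] (fderiv ℝ g u₀).toLinearMap.ker)
      (Φ : OpenPartialHomeomorph E (F × (fderiv ℝ g u₀).toLinearMap.ker)),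
      u₀ ∈ Φ.source ∧ Φ.source ⊆ U ∧ (∀ u, Φ u = (g u, W u)) ∧
      ContDiffOn ℝ ∞ Φ.symm Φ.target := by
  obtain ⟨W, A, hA⟩ := ContinuousLinearMap.exists_prod_equiv_of_surjective hs
  have : FiniteDimensional ℝ F := Module.Finite.of_surjective (fderiv ℝ g u₀).toLinearMap hs
  have := FiniteDimensional.complete ℝ E
  have hgd : HasFDerivAt g (fderiv ℝ g u₀) u₀ :=
    ((hg.contDiffAt (hU.mem_nhds hu₀)).differentiableAt (by simp)).hasFDerivAt
  obtain ⟨Φ, h1, h2, h3, h4⟩ := exists_openPartialHomeomorph_of_contDiffOn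
    (f := fun u => (g u, W u)) hU (hg.prodMk W.contDiff.contDiffOn) hu₀ (A := A)
    ((hgd.prodMk W.hasFDerivAt).congr_fderiv (by ext x : 1; exact (hA x).symm))
  exact ⟨W, Φ, h1, h2, h3, h4⟩

/-- Immersions have local smooth left inverses. -/
theorem exists_leftInverse_of_immersion [FiniteDimensional ℝ E] {g : E → F} {U : Set E}
    [FiniteDimensional ℝ F]
    (hU : IsOpen U) (hg : ContDiffOn ℝ ∞ g U) {u₀ : E} (hu₀ : u₀ ∈ U)
    (hs : Function.Injective (fderiv ℝ g u₀)) :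
    ∃ (V : Set F) (r : F → E), IsOpen V ∧ g u₀ ∈ V ∧ ContDiffOn ℝ ∞ r V ∧ MapsTo r V U ∧
      ∀ᶠ u in 𝓝 u₀, r (g u) = u := by
  have := FiniteDimensional.complete ℝ E
  obtain ⟨Λ', hΛ'⟩ := LinearMap.exists_leftInverse_of_injective (fderiv ℝ g u₀).toLinearMap
    (LinearMap.ker_eq_bot.2 hs)
  set Λ : F →L[ℝ] E := LinearMap.toContinuousLinearMap Λ'
  have hgd : HasFDerivAt g (fderiv ℝ g u₀) u₀ :=
    ((hg.contDiffAt (hU.mem_nhds hu₀)).differentiableAt (by simp)).hasFDerivAt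
  obtain ⟨Φ, h1, h2, h3, h4⟩ := exists_openPartialHomeomorph_of_contDiffOn
    -- `Λ` is a linear left inverse of the derivative, so `Λ ∘ g` has derivative the identity at
    -- `u₀`; the left inverse of `g` is `(Λ ∘ g)⁻¹ ∘ Λ`.
    (f := fun u => Λ (g u)) hU (Λ.contDiff.comp_contDiffOn hg) hu₀
    (A := ContinuousLinearEquiv.refl ℝ E)
    ((Λ.hasFDerivAt.comp u₀ hgd).congr_fderiv (by
      ext x; exact LinearMap.congr_fun hΛ' x))
  refine ⟨Λ ⁻¹' Φ.target, Φ.symm ∘ Λ, Φ.open_target.preimage Λ.continuous, ?_,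
    h4.comp Λ.contDiff.contDiffOn (fun x hx => hx), fun x hx => h2 (Φ.map_target hx), ?_⟩
  · have := Φ.map_source h1
    rwa [h3] at this
  · filter_upwards [Φ.open_source.mem_nhds h1] with u hu
    rw [Function.comp_apply, ← h3, Φ.left_inv hu]

end InverseFunction

/-! ### Projected curves tangent to the characteristic distribution are Hamiltonian. -/

section Lift

variable {E F : Type*} [NormedAddCommGroup E] [NormedSpace ℝ E] [FiniteDimensional ℝ E]
  [NormedAddCommGroup F] [NormedSpace ℝ F] [FiniteDimensional ℝ F]

theorem eventually_Ioo_of_eventually_nhds {p : ℝ → Prop} {t₀ : ℝ} (h : ∀ᶠ t in 𝓝 t₀, p t) :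
    ∃ ε > 0, ∀ t ∈ Ioo (t₀ - ε) (t₀ + ε), p t := by
  obtain ⟨ε, hε, hb⟩ := Metric.eventually_nhds_iff_ball.1 h
  exact ⟨ε, hε, by rwa [Real.ball_eq_Ioo] at hb⟩

/-- Integral curves of a vector field whose image under a submersion `g` is, at every point, tangent to
the characteristic distribution of a Poisson structure are mapped to Hamiltonian curves by `g`. -/
theorem IsLocalPoisson.exists_hamiltonian_of_integralCurve {O : Set F}
    {P : F → (F →L[ℝ] ℝ) →L[ℝ] F} (h : IsLocalPoisson O P) {Ω : Set E} (hΩ : IsOpen Ω)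
    {X : ℝ × E → E} (hX : ContDiffOn ℝ ∞ X (univ ×ˢ Ω)) {g : E → F} (hg : ContDiffOn ℝ ∞ g Ω)
    (hgO : MapsTo g Ω O)
    (hXP : ∀ t, ∀ u ∈ Ω, fderiv ℝ g u (X (t, u)) ∈ (P (g u)).toLinearMap.range)
    {w : ℝ → E} {t₀ : ℝ} (hw₀ : w t₀ ∈ Ω) (hs : Function.Surjective (fderiv ℝ g (w t₀)))
    (hw : ∀ᶠ t in 𝓝 t₀, HasDerivAt w (X (t, w t)) t) :
    ∃ ε > 0, ∃ α : ℝ → F →L[ℝ] ℝ, ContDiffOn ℝ ∞ α (Ioo (t₀ - ε) (t₀ + ε)) ∧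
      ∀ t ∈ Ioo (t₀ - ε) (t₀ + ε), fderiv ℝ g (w t) (X (t, w t)) = P (g (w t)) (α t) := by
  have := FiniteDimensional.complete ℝ E
  have := FiniteDimensional.complete ℝ F
  obtain ⟨O', θ, hO', hm₀, hOO', hθ, hPθ⟩ :=
    exists_smooth_rightInverse_on_range h.isOpen h.contDiffOn (hgO hw₀)
  set Ω' := Ω ∩ g ⁻¹' O' with hΩ'
  have hΩ'o : IsOpen Ω' := hg.continuousOn.isOpen_inter_preimage hΩ hO'
  have hw₀' : w t₀ ∈ Ω' := ⟨hw₀, hm₀⟩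
  obtain ⟨N, W, Φ, hΦ₀, hΦΩ, hΦ, hΦs⟩ : ∃ (N : Submodule ℝ E) (W : E →L[ℝ] N)
      (Φ : OpenPartialHomeomorph E (F × N)), w t₀ ∈ Φ.source ∧ Φ.source ⊆ Ω' ∧
      (∀ u, Φ u = (g u, W u)) ∧ ContDiffOn ℝ ∞ Φ.symm Φ.target :=
    ⟨_, exists_submersion_coordinates hΩ'o (hg.mono inter_subset_left) hw₀' hs⟩
  have hgd : ContDiffOn ℝ ∞ (fderiv ℝ g) Ω := hg.fderiv_of_isOpen hΩ (by simp)
  -- the coefficients of the Hamiltonian vector field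
  set a : ℝ × E → F →L[ℝ] ℝ := fun q => θ (g q.2) (fderiv ℝ g q.2 (X q)) with ha
  have hsnd : ContDiffOn ℝ ∞ (Prod.snd : ℝ × E → E) (univ ×ˢ Ω') := contDiffOn_snd
  have hsndm : MapsTo (Prod.snd : ℝ × E → E) (univ ×ˢ Ω') Ω' := fun q hq => hq.2
  have hXs : ContDiffOn ℝ ∞ X (univ ×ˢ Ω') := hX.mono (prod_mono le_rfl inter_subset_left)
  have has : ContDiffOn ℝ ∞ a (univ ×ˢ Ω') :=
    (hθ.comp ((hg.mono inter_subset_left).comp hsnd hsndm) fun q hq => hq.2.2).clm_apply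
      (((hgd.mono inter_subset_left).comp hsnd hsndm).clm_apply hXs)
  set T : Set (ℝ × (F × N)) := univ ×ˢ Φ.target with hT
  have hTo : IsOpen T := isOpen_univ.prod Φ.open_target
  set σ : ℝ × (F × N) → ℝ × E := fun q => (q.1, Φ.symm q.2) with hσ
  have hσs : ContDiffOn ℝ ∞ σ T :=
    contDiffOn_fst.prodMk (hΦs.comp contDiffOn_snd fun q hq => hq.2)
  have hσm : MapsTo σ T (univ ×ˢ Ω') := fun q hq => ⟨mem_univ _, hΦΩ (Φ.map_target hq.2)⟩
  have hsymm : ∀ y ∈ Φ.target, g (Φ.symm y) = y.1 := fun y hy => by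
    have := congrArg Prod.fst (Φ.right_inv hy)
    rwa [hΦ] at this
  -- This is `X` in the coordinates `Φ = (g, W)`, with the `F`-component `dg X` replaced by `P a`.
  -- The two agree where the rank of `P` is at most its value at the start. Solutions of `V` have a
  -- Hamiltonian first component whatever the rank, so the rank bound holds along them; there `V` is
  -- `X`, and uniqueness identifies the solution with `w`.
  set V : ℝ × (F × N) → F × N := fun q => (P q.2.1 (a (σ q)), W (X (σ q))) with hV
  have hVs : ContDiffOn ℝ ∞ V T := by
    refine ContDiffOn.prodMk (ContDiffOn.clm_apply ?_ (has.comp hσs hσm))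
      (W.contDiff.comp_contDiffOn (hXs.comp hσs hσm))
    refine h.contDiffOn.comp (contDiff_fst.comp contDiff_snd).contDiffOn fun q hq => ?_
    have := (hσm hq).2.2
    rw [← hsymm _ hq.2]
    exact hOO' this
  have hy₀ : (t₀, Φ (w t₀)) ∈ T := ⟨mem_univ _, Φ.map_source hΦ₀⟩
  obtain ⟨z, hz₀, hz⟩ := exists_integralCurve_of_contDiffAt (v := V)
    ((hVs.contDiffAt (hTo.mem_nhds hy₀)).of_le (by simp))
  have hzT : ∀ᶠ t in 𝓝 t₀, (t, z t) ∈ T := by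
    have hc : ContinuousAt (fun t => (t, z t)) t₀ :=
      continuousAt_id.prodMk hz.self_of_nhds.continuousAt
    exact hc (hTo.mem_nhds (by simpa [hz₀] using hy₀))
  obtain ⟨ε, hε, hzε⟩ := eventually_Ioo_of_eventually_nhds (hz.and hzT)
  have hI : Ioo (t₀ - ε) (t₀ + ε) ∈ 𝓝 t₀ := Ioo_mem_nhds (by linarith) (by linarith)
  have hzs : ContDiffAt ℝ ∞ z t₀ := (contDiffOn_of_hasDerivAt hTo hVs (fun t ht => (hzε t ht).1)
    (fun t ht => (hzε t ht).2)).contDiffAt hI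
  have hzT₀ : (t₀, z t₀) ∈ T := hzT.self_of_nhds
  have hidz : ContDiffAt ℝ ∞ (fun t => (t, z t)) t₀ := contDiffAt_id.prodMk hzs
  have hαs : ContDiffAt ℝ ∞ (fun t => a (σ (t, z t))) t₀ :=
    ContDiffAt.comp t₀ (g := fun q => a (σ q))
      ((has.comp hσs hσm).contDiffAt (hTo.mem_nhds hzT₀)) hidz
  have hz1 : (z t₀).1 = g (w t₀) := by rw [hz₀, hΦ]
  have hrank : ∀ᶠ t in 𝓝 t₀, Module.finrank ℝ (P (z t).1).toLinearMap.range ≤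
      Module.finrank ℝ (P (z t₀).1).toLinearMap.range := by
    refine h.eventually_finrank_le (m := fun t => (z t).1) (α := fun t => a (σ (t, z t))) ?_
      ((contDiffAt_fst.comp t₀ hzs).of_le (by simp)) (hαs.of_le (by simp)) ?_
    · rw [hz1]; exact hgO hw₀
    · filter_upwards [hz] with t ht using ht.fst
  -- the lifted curve is an integral curve
  have hu : ∀ᶠ t in 𝓝 t₀, HasDerivAt (fun t => Φ.symm (z t)) (X (t, Φ.symm (z t))) t := by
    filter_upwards [hz, hzT, hrank] with t ht htT htr
    set u := Φ.symm (z t) with hu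
    have hus : u ∈ Φ.source := Φ.map_target htT.2
    have huΩ := hΦΩ hus
    have hgu : g u = (z t).1 := hsymm _ htT.2
    have hfix : P (z t).1 (a (t, u)) = fderiv ℝ g u (X (t, u)) := by
      have := hPθ (g u) huΩ.2 (by rw [hgu, ← hz1]; exact htr) _ (hXP t u huΩ.1)
      rw [← hgu]; exact this
    have hΦd : HasFDerivAt Φ ((fderiv ℝ g u).prod W) u := by
      have : (Φ : E → F × N) = fun u => (g u, W u) := funext hΦ
      rw [this]
      exact ((hg.contDiffAt (hΩ.mem_nhds huΩ.1)).differentiableAt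
        (by simp)).hasFDerivAt.prodMk W.hasFDerivAt
    have h1 := ((hΦs.contDiffAt (Φ.open_target.mem_nhds htT.2)).differentiableAt
      (by simp)).hasFDerivAt.comp_hasDerivAt t ht
    refine h1.congr_deriv ?_
    have h2 := Φ.fderiv_symm_apply_of_hasFDerivAt hΦs hus hΦd (X (t, u))
    rw [Φ.right_inv htT.2] at h2
    refine Eq.trans ?_ h2
    congr 1
    exact Prod.ext hfix rfl
  have huw : ∀ᶠ t in 𝓝 t₀, Φ.symm (z t) = w t := by
    have hst : Φ.symm (z t₀) = w t₀ := by rw [hz₀, Φ.left_inv hΦ₀]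
    refine integralCurve_eventuallyEq_of_contDiffAt (v := X) ?_ hu hw hst
    rw [hst]
    exact (hX.contDiffAt ((isOpen_univ.prod hΩ).mem_nhds ⟨mem_univ _, hw₀⟩)).of_le (by simp)
  have hwΩ : ∀ᶠ t in 𝓝 t₀, w t ∈ Ω' :=
    hw.self_of_nhds.continuousAt (hΩ'o.mem_nhds hw₀')
  obtain ⟨δ, hδ, H⟩ := eventually_Ioo_of_eventually_nhds (hw.and (hwΩ.and (huw.and (hrank.and hzT))))
  refine ⟨δ, hδ, fun t => a (t, w t), ?_, fun t ht => ?_⟩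
  · refine has.comp (contDiffOn_id.prodMk ?_) fun t ht => ⟨mem_univ _, (H t ht).2.1⟩
    exact contDiffOn_of_hasDerivAt (isOpen_univ.prod hΩ'o) hXs (fun t ht => (H t ht).1)
      fun t ht => ⟨mem_univ _, (H t ht).2.1⟩
  · obtain ⟨-, hwt, hut, htr, htT⟩ := H t ht
    refine (hPθ (g (w t)) hwt.2 ?_ _ (hXP t _ hwt.1)).symm
    have : g (w t) = (z t).1 := by rw [← hut]; exact hsymm _ htT.2
    rw [this, ← hz1]
    exact htr

end Lift

/-! ### Globally defined coordinate functions. -/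

noncomputable section Coordinates

variable {E : Type*} [NormedAddCommGroup E] [NormedSpace ℝ E]
  {M : Type*} [TopologicalSpace M] [ChartedSpace E M]

/-- Smooth coordinates on an open subset of a manifold, with a smooth extension of the coordinate
functions to the whole manifold. -/
structure GlobalCoord (E : Type*) [NormedAddCommGroup E] [NormedSpace ℝ E]
    (M : Type*) [TopologicalSpace M] [ChartedSpace E M] where
  toFun : M → E
  e : OpenPartialHomeomorph M E
  contMDiff : ContMDiff 𝓘(ℝ, E) 𝓘(ℝ, E) ∞ toFun
  eqOn : ∀ x ∈ e.source, e x = toFun x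
  contMDiffOn_symm : ContMDiffOn 𝓘(ℝ, E) 𝓘(ℝ, E) ∞ e.symm e.target

/-- A chart times a bump function, used where the bump is 1. Global coordinate functions are needed
because the axioms of `PoissonStructure` and the Hamiltonians of `HamiltonianStep` only involve
functions on all of `M`. -/
theorem GlobalCoord.exists_mem_source [FiniteDimensional ℝ E] [T2Space M] [IsManifold 𝓘(ℝ, E) ∞ M]
    (x₀ : M) : ∃ c : GlobalCoord E M, x₀ ∈ c.e.source := by
  obtain ⟨b⟩ : Nonempty (SmoothBumpFunction 𝓘(ℝ, E) x₀) := inferInstance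
  set s : Set M := interior {x | b x = 1} with hs
  have hx₀ : x₀ ∈ s := mem_interior_iff_mem_nhds.2 b.eventuallyEq_one
  refine ⟨⟨fun x => b x • chartAt E x₀ x, (chartAt E x₀).restrOpen s isOpen_interior,
    b.contMDiff_smul (contMDiffOn_chart (I := 𝓘(ℝ, E))), fun x hx => ?_, ?_⟩, ?_⟩
  · have : b x = 1 := interior_subset (s := {x | b x = 1}) hx.2
    simp [this]
  · exact (contMDiffOn_chart_symm (I := 𝓘(ℝ, E)) (x := x₀)).mono fun y hy => hy.1
  · exact ⟨mem_chart_source E x₀, hx₀⟩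

namespace GlobalCoord

variable (c : GlobalCoord E M)

/-- The differential of the coordinates. -/
def d (z : M) : TangentSpace 𝓘(ℝ, E) z →ₗ[ℝ] E := tangentMapAt E E c.toFun z

theorem map_source {z : M} (hz : z ∈ c.e.source) : c.toFun z ∈ c.e.target :=
  c.eqOn z hz ▸ c.e.map_source hz

theorem left_inv {z : M} (hz : z ∈ c.e.source) : c.e.symm (c.toFun z) = z :=
  c.eqOn z hz ▸ c.e.left_inv hz

theorem right_inv {u : E} (hu : u ∈ c.e.target) : c.toFun (c.e.symm u) = u := by
  rw [← c.eqOn _ (c.e.map_target hu), c.e.right_inv hu]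

theorem contDiffOn_comp_symm {F : Type*} [NormedAddCommGroup F] [NormedSpace ℝ F] {f : M → F}
    {s : Set M} (hf : ContMDiffOn 𝓘(ℝ, E) 𝓘(ℝ, F) ∞ f s) :
    ContDiffOn ℝ ∞ (f ∘ c.e.symm) (c.e.target ∩ c.e.symm ⁻¹' s) :=
  contMDiffOn_iff_contDiffOn.1 (hf.comp (c.contMDiffOn_symm.mono inter_subset_left)
    fun _ hu => hu.2)

theorem contDiffOn_comp_symm_target {F : Type*} [NormedAddCommGroup F] [NormedSpace ℝ F] {f : M → F}
    (hf : ContMDiff 𝓘(ℝ, E) 𝓘(ℝ, F) ∞ f) : ContDiffOn ℝ ∞ (f ∘ c.e.symm) c.e.target := by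
  simpa using c.contDiffOn_comp_symm (s := univ) hf.contMDiffOn

/-- The derivative of a map with values in a vector space, in coordinates. -/
theorem tangentMapAt_eq_fderiv {F : Type*} [NormedAddCommGroup F] [NormedSpace ℝ F] {f : M → F} {z : M}
    (hz : z ∈ c.e.source) (hf : ContMDiffAt 𝓘(ℝ, E) 𝓘(ℝ, F) ∞ f z) (v : TangentSpace 𝓘(ℝ, E) z) :
    tangentMapAt E F f z v = fderiv ℝ (f ∘ c.e.symm) (c.toFun z) (c.d z v) := by
  have hs : ContMDiffAt 𝓘(ℝ, E) 𝓘(ℝ, E) ∞ c.e.symm (c.toFun z) :=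
    c.contMDiffOn_symm.contMDiffAt (c.e.open_target.mem_nhds (c.map_source hz))
  have hfs : MDifferentiableAt 𝓘(ℝ, E) 𝓘(ℝ, F) (f ∘ c.e.symm) (c.toFun z) := by
    refine (ContMDiffAt.comp (c.toFun z) (I' := 𝓘(ℝ, E)) ?_ hs).mdifferentiableAt (by simp)
    rwa [c.left_inv hz]
  have h1 : f =ᶠ[𝓝 z] (f ∘ c.e.symm) ∘ c.toFun := by
    filter_upwards [c.e.open_source.mem_nhds hz] with x hx
    simp [c.left_inv hx]
  have h2 := mfderiv_comp z hfs (c.contMDiff.mdifferentiable (by simp) z)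
  have h3 : mfderiv 𝓘(ℝ, E) 𝓘(ℝ, F) f z = mfderiv 𝓘(ℝ, E) 𝓘(ℝ, F) ((f ∘ c.e.symm) ∘ c.toFun) z :=
    h1.mfderiv_eq
  have h4 : tangentMapAt E F f z v = mfderiv 𝓘(ℝ, E) 𝓘(ℝ, F) ((f ∘ c.e.symm) ∘ c.toFun) z v :=
    congrArg (fun A : E →L[ℝ] F => A v) h3
  rw [h4, h2, mfderiv_eq_fderiv]
  rfl

theorem d_bijective {z : M} (hz : z ∈ c.e.source) : Function.Bijective (c.d z) := by
  have hs : MDifferentiableAt 𝓘(ℝ, E) 𝓘(ℝ, E) c.e.symm (c.toFun z) :=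
    (c.contMDiffOn_symm.contMDiffAt
      (c.e.open_target.mem_nhds (c.map_source hz))).mdifferentiableAt (by simp)
  have hc : MDifferentiableAt 𝓘(ℝ, E) 𝓘(ℝ, E) c.toFun (c.e.symm (c.toFun z)) :=
    c.contMDiff.mdifferentiable (by simp) _
  have hc' : MDifferentiableAt 𝓘(ℝ, E) 𝓘(ℝ, E) c.toFun z := c.contMDiff.mdifferentiable (by simp) _
  have h1 := mfderiv_comp z hs hc'
  have h2 := mfderiv_comp (c.toFun z) hc hs
  have e1 : c.e.symm ∘ c.toFun =ᶠ[𝓝 z] id := by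
    filter_upwards [c.e.open_source.mem_nhds hz] with x hx using c.left_inv hx
  have e2 : c.toFun ∘ c.e.symm =ᶠ[𝓝 (c.toFun z)] id := by
    filter_upwards [c.e.open_target.mem_nhds (c.map_source hz)] with x hx using c.right_inv hx
  rw [e1.mfderiv_eq, mfderiv_id] at h1
  rw [e2.mfderiv_eq, mfderiv_id, c.left_inv hz] at h2
  constructor
  · refine Function.LeftInverse.injective
      (g := fun v : E => (mfderiv 𝓘(ℝ, E) 𝓘(ℝ, E) c.e.symm (c.toFun z) v : E)) fun v => ?_
    exact (congrArg (fun A : E →L[ℝ] E => A v) h1).symm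
  · refine Function.RightInverse.surjective
      (g := fun v : E => (mfderiv 𝓘(ℝ, E) 𝓘(ℝ, E) c.e.symm (c.toFun z) v : E)) fun v => ?_
    exact (congrArg (fun A : E →L[ℝ] E => A v) h2).symm

end GlobalCoord

end Coordinates

theorem contDiffOn_of_forall_dual {D F : Type*} [NormedAddCommGroup D] [NormedSpace ℝ D]
    [NormedAddCommGroup F] [NormedSpace ℝ F] [FiniteDimensional ℝ F] {f : D → F} {s : Set D}
    (h : ∀ η : F →L[ℝ] ℝ, ContDiffOn ℝ ∞ (fun x => η (f x)) s) : ContDiffOn ℝ ∞ f s := by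
  set b := (Module.finBasis ℝ F).equivFunL
  rw [← b.comp_contDiffOn_iff, contDiffOn_pi]
  exact fun i => h ((ContinuousLinearMap.proj i).comp b.toContinuousLinearMap)

/-! ### The coordinate expression of a Poisson structure. -/

noncomputable section LocalTensor

variable {E : Type*} [NormedAddCommGroup E] [NormedSpace ℝ E]
  {M : Type*} [TopologicalSpace M] [ChartedSpace E M]

theorem ContMDiff.clm_comp_left {F : Type*} [NormedAddCommGroup F] [NormedSpace ℝ F] {f : M → F}
    (ξ : F →L[ℝ] ℝ) (hf : ContMDiff 𝓘(ℝ, E) 𝓘(ℝ, F) ∞ f) :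
    ContMDiff 𝓘(ℝ, E) 𝓘(ℝ, ℝ) ∞ (fun x => ξ (f x)) :=
  ξ.contMDiff.comp hf

theorem dAt_clm_comp {F : Type*} [NormedAddCommGroup F] [NormedSpace ℝ F] {f : M → F} {z : M}
    (ξ : F →L[ℝ] ℝ) (hf : MDifferentiableAt 𝓘(ℝ, E) 𝓘(ℝ, F) f z)
    (v : TangentSpace 𝓘(ℝ, E) z) :
    dAt E (fun x => ξ (f x)) z v = ξ (tangentMapAt E F f z v) := by
  have h := mfderiv_comp z (g := ξ) (f := f)
    (ξ.contMDiff.mdifferentiable (n := 1) (by simp) (f z)) hf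
  have h2 : dAt E (fun x => ξ (f x)) z v = mfderiv 𝓘(ℝ, E) 𝓘(ℝ, ℝ) (ξ ∘ f) z v := rfl
  rw [h2, h, ContinuousLinearMap.mfderiv_eq]
  rfl

namespace GlobalCoord

variable (c : GlobalCoord E M)

/-- A covector of the coordinate space, pulled back to the manifold. -/
def pull (z : M) (ξ : E →L[ℝ] ℝ) : Module.Dual ℝ (TangentSpace 𝓘(ℝ, E) z) :=
  ξ.toLinearMap ∘ₗ c.d z

theorem dAt_eq_pull {f : M → ℝ} {z : M} (hz : z ∈ c.e.source)
    (hf : ContMDiffAt 𝓘(ℝ, E) 𝓘(ℝ, ℝ) ∞ f z) :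
    dAt E f z = c.pull z (fderiv ℝ (f ∘ c.e.symm) (c.toFun z)) := by
  ext v
  exact c.tangentMapAt_eq_fderiv hz hf v

theorem dAt_clm_eq_pull (ξ : E →L[ℝ] ℝ) (z : M) : dAt E (fun x => ξ (c.toFun x)) z = c.pull z ξ := by
  ext v
  exact dAt_clm_comp ξ (c.contMDiff.mdifferentiable (by simp) z) v

theorem hasDerivAt_comp {γ : ℝ → M} {t : ℝ} {v : TangentSpace 𝓘(ℝ, E) (γ t)}
    (hγ : HasMFDerivAt 𝓘(ℝ, ℝ) 𝓘(ℝ, E) γ t ((1 : ℝ →L[ℝ] ℝ).smulRight v)) :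
    HasDerivAt (fun t => c.toFun (γ t)) (c.d (γ t) v) t := by
  have h1 := (c.contMDiff.mdifferentiable (by simp) (γ t)).hasMFDerivAt.comp t hγ
  obtain ⟨A, hA, hAv⟩ : ∃ A : ℝ →L[ℝ] E, HasFDerivAt (fun t => c.toFun (γ t)) A t ∧
      A 1 = c.d (γ t) ((1 : ℝ) • v) := ⟨_, hasMFDerivAt_iff_hasFDerivAt.1 h1, rfl⟩
  rw [one_smul] at hAv
  exact hAv ▸ hA.hasDerivAt

variable [FiniteDimensional ℝ E]

theorem pull_surjective {z : M} (hz : z ∈ c.e.source) : Function.Surjective (c.pull z) := by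
  intro ζ
  set A := LinearEquiv.ofBijective (c.d z) (c.d_bijective hz)
  refine ⟨LinearMap.toContinuousLinearMap (ζ ∘ₗ A.symm.toLinearMap), ?_⟩
  ext v
  exact congrArg ζ (A.symm_apply_apply v)

/-- The Poisson tensor at the point with the coordinates `u`. -/
def tensor (π : PoissonStructure E M) (u : E) : (E →L[ℝ] ℝ) →L[ℝ] E :=
  LinearMap.toContinuousLinearMap
    { toFun := fun ξ => c.d (c.e.symm u) (π.sharp (c.e.symm u) (c.pull (c.e.symm u) ξ))
      map_add' := fun ξ η => by
        have : c.pull (c.e.symm u) (ξ + η) = c.pull (c.e.symm u) ξ + c.pull (c.e.symm u) η := rfl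
        rw [this, map_add, map_add]
      map_smul' := fun a ξ => by
        have : c.pull (c.e.symm u) (a • ξ) = a • c.pull (c.e.symm u) ξ := rfl
        rw [this, map_smul, map_smul]; rfl }

variable (π : PoissonStructure E M)

theorem tensor_apply (u : E) (ξ : E →L[ℝ] ℝ) : c.tensor π u ξ =
    c.d (c.e.symm u) (π.sharp (c.e.symm u) (c.pull (c.e.symm u) ξ)) := rfl

theorem tensor_toFun {z : M} (hz : z ∈ c.e.source) (ξ : E →L[ℝ] ℝ) :
    c.tensor π (c.toFun z) ξ = c.d z (π.sharp z (c.pull z ξ)) := by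
  rw [tensor_apply, c.left_inv hz]

theorem apply_tensor (u : E) (ξ η : E →L[ℝ] ℝ) : η (c.tensor π u ξ) =
    bracketOf π.sharp (fun x => ξ (c.toFun x)) (fun x => η (c.toFun x)) (c.e.symm u) := by
  rw [bracketOf, c.dAt_clm_eq_pull, c.dAt_clm_eq_pull]
  rfl

theorem d_ham {f : M → ℝ} {z : M} (hz : z ∈ c.e.source)
    (hf : ContMDiffAt 𝓘(ℝ, E) 𝓘(ℝ, ℝ) ∞ f z) :
    c.d z (π.ham f z) = c.tensor π (c.toFun z) (fderiv ℝ (f ∘ c.e.symm) (c.toFun z)) := by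
  rw [c.tensor_toFun π hz, ← c.dAt_eq_pull hz hf]
  rfl

theorem range_tensor {z : M} (hz : z ∈ c.e.source) :
    (c.tensor π (c.toFun z)).toLinearMap.range = (π.sharp z).range.map (c.d z) := by
  ext v
  constructor
  · rintro ⟨ξ, rfl⟩
    exact ⟨_, ⟨c.pull z ξ, rfl⟩, (c.tensor_toFun π hz ξ).symm⟩
  · rintro ⟨_, ⟨ζ, rfl⟩, rfl⟩
    obtain ⟨ξ, rfl⟩ := c.pull_surjective hz ζ
    exact ⟨ξ, c.tensor_toFun π hz ξ⟩

theorem finrank_range_tensor {z : M} (hz : z ∈ c.e.source) :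
    Module.finrank ℝ (c.tensor π (c.toFun z)).toLinearMap.range =
      Module.finrank ℝ (π.sharp z).range := by
  rw [c.range_tensor π hz]
  exact (LinearEquiv.finrank_eq (Submodule.equivMapOfInjective (c.d z) (c.d_bijective hz).1 _)).symm

theorem contDiffOn_tensor : ContDiffOn ℝ ∞ (c.tensor π) c.e.target := by
  refine contDiffOn_clm_apply.2 fun ξ => contDiffOn_of_forall_dual fun η => ?_
  simp_rw [c.apply_tensor π]
  exact c.contDiffOn_comp_symm_target (π.smooth _ _ (c.contMDiff.clm_comp_left ξ)
    (c.contMDiff.clm_comp_left η))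

/-- Linear functions of the coordinates have constant differentials, so their double brackets
involve only the first derivative of the tensor, and their Jacobi identity is the local one. -/
theorem isLocalPoisson_tensor : IsLocalPoisson c.e.target (c.tensor π) where
  isOpen := c.e.open_target
  contDiffOn := c.contDiffOn_tensor π
  skew u _ ξ η := π.skew _ (c.pull _ ξ) (c.pull _ η)
  jacobi u hu := by
    have hz := c.e.map_target hu
    have key : ∀ α β γ : E →L[ℝ] ℝ, bracketOf π.sharp (fun x => α (c.toFun x))
        (bracketOf π.sharp (fun x => β (c.toFun x)) (fun x => γ (c.toFun x))) (c.e.symm u) =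
        γ (fderiv ℝ (c.tensor π) u (c.tensor π u α) β) := by
      intro α β γ
      have hs := π.smooth _ _ (c.contMDiff.clm_comp_left β) (c.contMDiff.clm_comp_left γ)
      have h1 := c.dAt_eq_pull hz hs.contMDiffAt
      rw [bracketOf, h1, c.dAt_clm_eq_pull, c.right_inv hu]
      have h2 : (bracketOf π.sharp (fun x => β (c.toFun x)) (fun x => γ (c.toFun x))) ∘ c.e.symm =
          fun u => γ (c.tensor π u β) := funext fun u => (c.apply_tensor π u β γ).symm
      have hd := (((c.contDiffOn_tensor π).contDiffAt (c.e.open_target.mem_nhds hu)).differentiableAt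
        (by simp)).hasFDerivAt
      have h3 := (γ.hasFDerivAt.comp u (hd.clm_apply (hasFDerivAt_const β u))).fderiv
      rw [h2]
      have h4 : fderiv ℝ (fun u => γ (c.tensor π u β)) u = _ := h3
      rw [h4]
      simp [pull, tensor_apply]
    intro α β γ
    rw [← key, ← key, ← key]
    exact π.jacobi _ _ _ (c.contMDiff.clm_comp_left α) (c.contMDiff.clm_comp_left β)
      (c.contMDiff.clm_comp_left γ) _

/-- A time-dependent Hamiltonian vector field, in coordinates. -/
theorem contDiffOn_ham {f : ℝ → M → ℝ}
    (hf : ContMDiff (𝓘(ℝ, ℝ).prod 𝓘(ℝ, E)) 𝓘(ℝ, ℝ) ∞ (fun q : ℝ × M => f q.1 q.2)) :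
    ContDiffOn ℝ ∞ (fun q : ℝ × E => c.tensor π q.2 (fderiv ℝ (f q.1 ∘ c.e.symm) q.2))
      (univ ×ˢ c.e.target) := by
  have hto : IsOpen ((univ : Set ℝ) ×ˢ c.e.target) := isOpen_univ.prod c.e.open_target
  have h1 : ContDiffOn ℝ ∞ (fun q : ℝ × E => f q.1 (c.e.symm q.2)) (univ ×ˢ c.e.target) := by
    have h := hf.comp_contMDiffOn (s := univ ×ˢ c.e.target)
      (contMDiffOn_fst.prodMk (c.contMDiffOn_symm.comp contMDiffOn_snd fun q hq => hq.2) :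
        ContMDiffOn (𝓘(ℝ, ℝ).prod 𝓘(ℝ, E)) (𝓘(ℝ, ℝ).prod 𝓘(ℝ, E)) ∞
          (fun q : ℝ × E => (q.1, c.e.symm q.2)) _)
    rw [← modelWithCornersSelf_prod, chartedSpaceSelf_prod] at h
    exact contMDiffOn_iff_contDiffOn.1 h
  have h2 := h1.fderiv_of_isOpen (m := ∞) hto (by simp)
  have h3 : ContDiffOn ℝ ∞ (fun q : ℝ × E => (fderiv ℝ (fun q : ℝ × E => f q.1 (c.e.symm q.2)) q).comp
      (ContinuousLinearMap.inr ℝ ℝ E)) (univ ×ˢ c.e.target) := h2.clm_comp contDiffOn_const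
  refine ContDiffOn.clm_apply ((c.contDiffOn_tensor π).comp contDiffOn_snd fun q hq => hq.2)
    (h3.congr fun q hq => ?_)
  have h4 := ((h1.contDiffAt (hto.mem_nhds hq)).differentiableAt (by simp)).hasFDerivAt
  exact (HasFDerivAt.comp q.2 (f := fun u : E => (q.1, u)) h4 (hasFDerivAt_prodMk_right q.1 q.2)).fderiv

end GlobalCoord

end LocalTensor

/-! ### Pointwise linear algebra of coregular fibres and of leaves. -/

section LinearAlgebra

variable {T T' : Type*} [AddCommGroup T] [Module ℝ T] [AddCommGroup T'] [Module ℝ T']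

/-- The tangential part of a coregular Poisson submersion: the image of `π^♯` is mapped into the image
of `π'^♯`. -/
theorem mem_range_sharp_of_disjoint {sharp : Module.Dual ℝ T →ₗ[ℝ] T}
    {sharp' : Module.Dual ℝ T' →ₗ[ℝ] T'} {A : T →ₗ[ℝ] T'}
    (skew : ∀ ξ η : Module.Dual ℝ T, η (sharp ξ) = -ξ (sharp η))
    (skew' : ∀ ξ η : Module.Dual ℝ T', η (sharp' ξ) = -ξ (sharp' η))
    (hA : ∀ ξ, A (sharp (ξ ∘ₗ A)) = sharp' ξ)
    (hd : Disjoint A.ker (A.ker.dualAnnihilator.map sharp)) (ξ : Module.Dual ℝ T) :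
    A (sharp ξ) ∈ sharp'.range := by
  -- Separate `A (sharp ξ)` from `im sharp'` by a covector `η` killing the latter. By skewness
  -- `sharp' η = 0`, so `sharp (η ∘ A)` lies in `ker A` and in `sharp ((ker A)°)`, hence vanishes;
  -- but then `η (A (sharp ξ)) = -ξ (sharp (η ∘ A)) = 0`.
  by_contra hv
  obtain ⟨η, hη, hker⟩ := Submodule.exists_le_ker_of_notMem hv
  have h1 : sharp' η = 0 := by
    rw [← Module.forall_dual_apply_eq_zero_iff ℝ]
    intro ζ
    rw [skew', neg_eq_zero]
    exact hker ⟨ζ, rfl⟩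
  have h2 : sharp (η ∘ₗ A) = 0 := by
    refine (Submodule.disjoint_def.1 hd) _ ?_ ⟨η ∘ₗ A, ?_, rfl⟩
    · rw [LinearMap.mem_ker, hA, h1]
    · refine (Submodule.mem_dualAnnihilator _).2 fun w hw => ?_
      rw [LinearMap.comp_apply, LinearMap.mem_ker.1 hw, map_zero]
  apply hη
  have h3 := skew ξ (η ∘ₗ A)
  rw [h2, map_zero, neg_zero] at h3
  exact h3

/-- The image of an injective Poisson map out of a symplectic space. -/
theorem range_sharp_eq_range_of_injective {sharp : Module.Dual ℝ T →ₗ[ℝ] T}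
    {sharp' : Module.Dual ℝ T' →ₗ[ℝ] T'} {A : T →ₗ[ℝ] T'} (hs : Function.Surjective sharp)
    (hA : ∀ ξ, A (sharp (ξ ∘ₗ A)) = sharp' ξ) (hinj : Function.Injective A) :
    sharp'.range = A.range := by
  apply le_antisymm
  · rintro _ ⟨ξ, rfl⟩
    exact ⟨_, hA ξ⟩
  · rintro _ ⟨w, rfl⟩
    obtain ⟨ζ, rfl⟩ := hs w
    obtain ⟨η, rfl⟩ := LinearMap.dualMap_surjective_of_injective hinj ζ
    exact ⟨η, (hA η).symm⟩

end LinearAlgebra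

/-- A map which is smooth on an interval agrees with a globally smooth map on a smaller interval. -/
theorem exists_contDiff_eq_on_Ioo {V : Type*} [NormedAddCommGroup V] [NormedSpace ℝ V] {α : ℝ → V}
    {t₀ ε : ℝ} (hε : 0 < ε) (hα : ContDiffOn ℝ ∞ α (Ioo (t₀ - ε) (t₀ + ε))) :
    ∃ δ > 0, δ ≤ ε ∧ ∃ β : ℝ → V, ContDiff ℝ ∞ β ∧ ∀ t ∈ Ioo (t₀ - δ) (t₀ + δ), β t = α t := by
  let χ : ContDiffBump t₀ := ⟨ε / 3, ε / 2, by linarith, by linarith⟩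
  refine ⟨ε / 3, by linarith, by linarith, fun t => χ t • α t, ?_, fun t ht => ?_⟩
  · refine contDiff_iff_contDiffAt.2 fun t => ?_
    by_cases ht : t ∈ Ioo (t₀ - ε) (t₀ + ε)
    · exact χ.contDiff.contDiffAt.smul (hα.contDiffAt (Ioo_mem_nhds ht.1 ht.2))
    · have h1 : t ∉ tsupport χ := fun h => ht (by
        rw [χ.tsupport_eq, Real.closedBall_eq_Icc] at h
        have h' : t ∈ Icc (t₀ - ε / 2) (t₀ + ε / 2) := h
        exact ⟨by linarith [h'.1], by linarith [h'.2]⟩)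
      refine contDiffAt_const (c := (0 : V)) |>.congr_of_eventuallyEq ?_
      filter_upwards [notMem_tsupport_iff_eventuallyEq.1 h1] with s hs
      simp [hs]
  · have : χ t = 1 := χ.one_of_mem_closedBall (by
      rw [Real.closedBall_eq_Icc]
      exact ⟨ht.1.le, ht.2.le⟩)
    simp [this]

/-! ### Images of Hamiltonian orbits. -/

namespace PoissonStructure

variable {E : Type*} [NormedAddCommGroup E] [NormedSpace ℝ E]
  {X : Type*} [TopologicalSpace X] [ChartedSpace E X]
  {F : Type*} [NormedAddCommGroup F] [NormedSpace ℝ F]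
  {M : Type*} [TopologicalSpace M] [ChartedSpace F M]
  {π : PoissonStructure E X} {π' : PoissonStructure F M} {p : X → M}

theorem IsCoregularPoissonSubmersion.tangentMapAt_sharp_mem [IsManifold 𝓘(ℝ, E) ∞ X]
    (hp : π.IsCoregularPoissonSubmersion π' p) (z : X)
    (ξ : Module.Dual ℝ (TangentSpace 𝓘(ℝ, E) z)) :
    tangentMapAt E F p z (π.sharp z ξ) ∈ (π'.sharp (p z)).range :=
  mem_range_sharp_of_disjoint (π.skew z) (π'.skew (p z)) (hp.map_sharp z)
    ((hp.coregular (p z)).2 z rfl) ξ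

theorem tangentMapAt_comp {G : Type*} [NormedAddCommGroup G] [NormedSpace ℝ G] {N : Type*}
    [TopologicalSpace N] [ChartedSpace G N] {g : M → N} {f : X → M}
    (hg : ContMDiff 𝓘(ℝ, F) 𝓘(ℝ, G) ∞ g) (hf : ContMDiff 𝓘(ℝ, E) 𝓘(ℝ, F) ∞ f) (z : X)
    (v : TangentSpace 𝓘(ℝ, E) z) :
    tangentMapAt E G (g ∘ f) z v = tangentMapAt F G g (f z) (tangentMapAt E F f z v) := by
  have h := mfderiv_comp z (hg.mdifferentiable (by simp) (f z)) (hf.mdifferentiable (by simp) z)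
  exact congrArg (fun A : E →L[ℝ] G => A v) h

theorem HamiltonianStep.symm {x y : X} (h : π.HamiltonianStep x y) : π.HamiltonianStep y x := by
  obtain ⟨f, hf, γ, a, b, hγ, s, hs, t, ht, rfl, rfl⟩ := h
  exact ⟨f, hf, γ, a, b, hγ, t, ht, s, hs, rfl, rfl⟩

variable [FiniteDimensional ℝ E] [FiniteDimensional ℝ F]

/-- A Hamiltonian curve is mapped to a curve which is locally Hamiltonian. -/
theorem eventually_hamiltonianStep_of_range [T2Space X] [IsManifold 𝓘(ℝ, E) ∞ X]
    [T2Space M] [IsManifold 𝓘(ℝ, F) ∞ M]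
    (hp : ContMDiff 𝓘(ℝ, E) 𝓘(ℝ, F) ∞ p)
    (hsurj : ∀ z, Function.Surjective (tangentMapAt E F p z))
    (hrange : ∀ z ξ, tangentMapAt E F p z (π.sharp z ξ) ∈ (π'.sharp (p z)).range)
    {f : ℝ → X → ℝ}
    (hf : ContMDiff (𝓘(ℝ, ℝ).prod 𝓘(ℝ, E)) 𝓘(ℝ, ℝ) ∞ (fun q : ℝ × X => f q.1 q.2))
    {γ : ℝ → X} {t₀ : ℝ} (hγ : ∀ᶠ t in 𝓝 t₀, HasMFDerivAt 𝓘(ℝ, ℝ) 𝓘(ℝ, E) γ t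
        ((1 : ℝ →L[ℝ] ℝ).smulRight (π.ham (f t) (γ t)))) :
    ∀ᶠ t in 𝓝 t₀, π'.HamiltonianStep (p (γ t₀)) (p (γ t)) := by
  obtain ⟨c, hc⟩ := GlobalCoord.exists_mem_source (E := E) (γ t₀)
  obtain ⟨c', hc'⟩ := GlobalCoord.exists_mem_source (E := F) (p (γ t₀))
  have hft : ∀ t, ContMDiff 𝓘(ℝ, E) 𝓘(ℝ, ℝ) ∞ (f t) := fun t =>
    hf.comp (contMDiff_const.prodMk contMDiff_id)
  set g : E → F := (c'.toFun ∘ p) ∘ c.e.symm with hg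
  have hcp : ContMDiff 𝓘(ℝ, E) 𝓘(ℝ, F) ∞ (c'.toFun ∘ p) := c'.contMDiff.comp hp
  set Ω : Set E := c.e.target ∩ c.e.symm ⁻¹' (p ⁻¹' c'.e.source) with hΩ
  have hΩo : IsOpen Ω :=
    c.e.isOpen_inter_preimage_symm (c'.e.open_source.preimage hp.continuous)
  have hgd : ∀ z ∈ c.e.source, ∀ v, fderiv ℝ g (c.toFun z) (c.d z v) =
      c'.d (p z) (tangentMapAt E F p z v) := fun z hz v => by
    rw [← c.tangentMapAt_eq_fderiv hz hcp.contMDiffAt, tangentMapAt_comp c'.contMDiff hp]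
    rfl
  set V : ℝ × E → E := fun q => c.tensor π q.2 (fderiv ℝ (f q.1 ∘ c.e.symm) q.2) with hV
  have hVham : ∀ t, ∀ z ∈ c.e.source, V (t, c.toFun z) = c.d z (π.ham (f t) z) := fun t z hz =>
    (c.d_ham π hz (hft t).contMDiffAt).symm
  have hgs : ContDiffOn ℝ ∞ g c.e.target := c.contDiffOn_comp_symm_target hcp
  have hgm : ∀ z ∈ c.e.source, g (c.toFun z) = c'.toFun (p z) := fun z hz => by
    simp [hg, c.left_inv hz]
  have hsrc : ∀ᶠ t in 𝓝 t₀, γ t ∈ c.e.source :=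
    hγ.self_of_nhds.continuousAt (c.e.open_source.mem_nhds hc)
  have hsrc' : ∀ᶠ t in 𝓝 t₀, p (γ t) ∈ c'.e.source :=
    (hp.continuous.continuousAt.comp hγ.self_of_nhds.continuousAt) (c'.e.open_source.mem_nhds hc')
  obtain ⟨ε, hε, α, hα, hαP⟩ := (c'.isLocalPoisson_tensor π').exists_hamiltonian_of_integralCurve
    hΩo (X := V) ((c.contDiffOn_ham π hf).mono (prod_mono le_rfl inter_subset_left))
    (g := g) (hgs.mono inter_subset_left) (fun u hu => by
      have := hgm _ (c.e.map_target hu.1)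
      rw [c.right_inv hu.1] at this
      rw [this]
      exact c'.map_source hu.2)
    (fun t u hu => by
      have hz := c.e.map_target hu.1
      have h1 := hVham t _ hz
      have h2 := hgm _ hz
      have h3 := hgd _ hz (π.ham (f t) (c.e.symm u))
      rw [c.right_inv hu.1] at h1 h2 h3
      rw [h1, h3, h2, c'.range_tensor π' hu.2]
      exact Submodule.mem_map_of_mem (hrange _ _))
    (w := fun t => c.toFun (γ t)) (t₀ := t₀)
    ⟨c.map_source hc, by simpa [c.left_inv hc] using hc'⟩
    (fun y => by
      obtain ⟨v', rfl⟩ := (c'.d_bijective hc').2 y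
      obtain ⟨v, rfl⟩ := hsurj _ v'
      exact ⟨c.d _ v, hgd _ hc v⟩)
    (by
      filter_upwards [hγ, hsrc] with t ht hts
      rw [hVham t _ hts]
      exact c.hasDerivAt_comp ht)
  -- A Hamiltonian must be smooth for all times, so the covectors are cut off in time; the
  -- Hamiltonian below is linear in the global coordinates, with coefficients `β`.
  obtain ⟨δ, hδ, hδε, β, hβ, hβα⟩ := exists_contDiff_eq_on_Ioo hε hα
  obtain ⟨δ', hδ', H⟩ := eventually_Ioo_of_eventually_nhds
    (hγ.and (hsrc.and (hsrc'.and (Ioo_mem_nhds (a := t₀ - δ) (b := t₀ + δ)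
      (by linarith) (by linarith)))))
  have ht₀ : t₀ ∈ Ioo (t₀ - δ') (t₀ + δ') := ⟨by linarith, by linarith⟩
  filter_upwards [Ioo_mem_nhds ht₀.1 ht₀.2] with t ht
  refine ⟨fun s m => β s (c'.toFun m), ?_, fun s => p (γ s), t₀ - δ', t₀ + δ', fun s hs => ?_,
    t₀, ht₀, t, ht, rfl, rfl⟩
  · exact (hβ.contMDiff.comp contMDiff_fst).clm_apply (c'.contMDiff.comp contMDiff_snd)
  · obtain ⟨h1, h2, h3, h4⟩ := H s hs
    have h5 := (hp.mdifferentiable (by simp) (γ s)).hasMFDerivAt.comp s h1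
    have h6 : tangentMapAt E F p (γ s) (π.ham (f s) (γ s)) =
        π'.ham (fun m => β s (c'.toFun m)) (p (γ s)) := by
      apply (c'.d_bijective h3).1
      have h7 := hαP s ⟨by linarith [h4.1], by linarith [h4.2]⟩
      rw [hVham s _ h2, hgd _ h2, hgm _ h2, ← hβα s h4, c'.tensor_toFun π' h3] at h7
      rw [h7, ham, c'.dAt_clm_eq_pull]
    refine h5.congr_mfderiv ?_
    ext
    change tangentMapAt E F p (γ s) ((1 : ℝ) • π.ham (f s) (γ s)) =
      (1 : ℝ) • π'.ham (fun m => β s (c'.toFun m)) (p (γ s))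
    rw [one_smul, one_smul, h6]

/-- The image of a Hamiltonian curve is Hamiltonian only near each time. Reachability along it is
reflexive-transitive and symmetric, so connectedness of the time interval joins any two of its
points by a finite chain of steps. -/
theorem mapsTo_hamiltonianOrbit [T2Space X] [IsManifold 𝓘(ℝ, E) ∞ X]
    [T2Space M] [IsManifold 𝓘(ℝ, F) ∞ M] (hp : ContMDiff 𝓘(ℝ, E) 𝓘(ℝ, F) ∞ p)
    (hsurj : ∀ z, Function.Surjective (tangentMapAt E F p z))
    (hrange : ∀ z ξ, tangentMapAt E F p z (π.sharp z ξ) ∈ (π'.sharp (p z)).range) (x : X) :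
    MapsTo p (π.hamiltonianOrbit x) (π'.hamiltonianOrbit (p x)) := by
  intro y hy
  refine Relation.ReflTransGen.lift' (r := π.HamiltonianStep) p ?_ x y hy
  rintro _ _ ⟨f, hf, γ, a, b, hγ, s, hs, t, ht, rfl, rfl⟩
  refine isPreconnected_Ioo.induction₂
    (fun s t => Relation.ReflTransGen π'.HamiltonianStep (p (γ s)) (p (γ t)))
    (fun r hr => ?_) (fun _ _ _ _ _ _ => Relation.ReflTransGen.trans) (fun s t _ _ h => ?_) hs ht
  · refine nhdsWithin_le_nhds ?_
    refine (eventually_hamiltonianStep_of_range hp hsurj hrange hf (t₀ := r) ?_).mono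
      fun _ h => Relation.ReflTransGen.single h
    filter_upwards [Ioo_mem_nhds hr.1 hr.2] with t ht using hγ t ht
  · have : Std.Symm π'.HamiltonianStep := ⟨fun _ _ h => h.symm⟩
    exact Relation.ReflTransGen.stdSymm.symm _ _ h

end PoissonStructure

/-! ### Local factorization through integral manifolds. -/

section EuclideanLift

variable {E F G H : Type*} [NormedAddCommGroup E] [NormedSpace ℝ E] [FiniteDimensional ℝ E]
  [NormedAddCommGroup F] [NormedSpace ℝ F] [FiniteDimensional ℝ F]
  [NormedAddCommGroup G] [NormedSpace ℝ G]
  [NormedAddCommGroup H] [NormedSpace ℝ H] [FiniteDimensional ℝ H]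

/-- A map `u` which is tangent to the distribution `im P` and stays in its locus of minimal rank
factors, locally, through integral manifolds of `im P`. -/
theorem exists_lift_of_tangent {O : Set F} (hO : IsOpen O) {P : F → H →L[ℝ] F}
    (hP : ContDiffOn ℝ ∞ P O) {A : Set E} (hA : IsOpen A) {j : E → F} (hj : ContDiffOn ℝ ∞ j A)
    (hjO : MapsTo j A O) {a₀ : E} (ha₀ : a₀ ∈ A) (hinj : Function.Injective (fderiv ℝ j a₀))
    (hjP : ∀ a ∈ A, (P (j a)).toLinearMap.range = (fderiv ℝ j a).toLinearMap.range)
    {B : Set G} (hB : IsOpen B) {u : G → F} (hu : ContDiffOn ℝ ∞ u B)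
    (hu' : ∀ x ∈ B, ∀ v, fderiv ℝ u x v ∈ (P (u x)).toLinearMap.range)
    (hrank : ∀ x ∈ B, Module.finrank ℝ (P (u x)).toLinearMap.range ≤
      Module.finrank ℝ (P (j a₀)).toLinearMap.range)
    {x₀ : G} (hx₀ : x₀ ∈ B) (hux₀ : u x₀ = j a₀) :
    ∃ (V : Set F) (r : F → E), IsOpen V ∧ u x₀ ∈ V ∧ ContDiffOn ℝ ∞ r V ∧ MapsTo r V A ∧
      ∀ᶠ x in 𝓝 x₀, j (r (u x)) = u x := by
  obtain ⟨V, r, hV, hjV, hr, hrA, hrj⟩ := exists_leftInverse_of_immersion hA hj ha₀ hinj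
  refine ⟨V, r, hV, hux₀ ▸ hjV, hr, hrA, ?_⟩
  obtain ⟨O', θ, hO', hm₀, hOO', hθ, hPθ⟩ := exists_smooth_rightInverse_on_range hO hP (hjO ha₀)
  -- A retraction onto the image of `j` near `j a₀`; the goal is that `u - k ∘ u` vanishes near
  -- `x₀`.
  set k : F → F := fun w => j (r w) with hk
  have hks : ContDiffOn ℝ ∞ k V := hj.comp hr hrA
  have hra₀ : r (j a₀) = a₀ := hrj.self_of_nhds
  have hk₀ : k (j a₀) = j a₀ := by simp [hk, hra₀]
  set W := V ∩ O' with hW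
  have hWo : IsOpen W := hV.inter hO'
  have hW₀ : j a₀ ∈ W := ⟨hjV, hm₀⟩
  -- Since `du` takes values in `im P`, where `P θ` is the identity under the rank bound, the
  -- derivative of `u - k ∘ u` is `Z (u) ∘ du`.
  set Z : F → F →L[ℝ] F := fun w =>
    (ContinuousLinearMap.id ℝ F - fderiv ℝ k w) ∘L P w ∘L θ w with hZ
  have hZs : ContDiffOn ℝ ∞ Z W := by
    refine ContDiffOn.clm_comp (contDiffOn_const.sub ?_) (ContDiffOn.clm_comp
      (hP.mono fun w hw => hOO' hw.2) (hθ.mono inter_subset_right))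
    exact (hks.fderiv_of_isOpen hV (by simp)).mono inter_subset_left
  obtain ⟨a₁, ha₁⟩ := eventually_nhds_iff.1 (hrj.eventually_nhds.and (hA.mem_nhds ha₀))
  -- On the image of `j` one has `im P = im dj`, which `dk` fixes because `k ∘ j = j`. As `Z` is
  -- Lipschitz, this yields `‖Z w‖ ≤ K ‖w - k w‖`, the input for Grönwall.
  have hZ0 : ∀ᶠ w in 𝓝 (j a₀), Z (k w) = 0 := by
    have hrc : ContinuousAt r (j a₀) := (hr.contDiffAt (hV.mem_nhds hjV)).continuousAt
    have hkc : ContinuousAt k (j a₀) := (hks.contDiffAt (hV.mem_nhds hjV)).continuousAt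
    have h1 : ∀ᶠ w in 𝓝 (j a₀), ∀ᶠ a in 𝓝 (r w), r (j a) = a := by
      have := hrj.eventually_nhds
      rw [← hra₀] at this
      exact hrc.eventually this
    have h2 : ∀ᶠ w in 𝓝 (j a₀), k w ∈ V := by
      refine hkc.eventually ?_
      rw [hk₀]
      exact hV.mem_nhds hjV
    filter_upwards [h1, h2, hV.mem_nhds hjV] with w hw1 hw2 hwV
    have hjd : HasFDerivAt j (fderiv ℝ j (r w)) (r w) :=
      ((hj.contDiffAt (hA.mem_nhds (hrA hwV))).differentiableAt (by simp)).hasFDerivAt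
    have hkd : HasFDerivAt k (fderiv ℝ k (k w)) (j (r w)) :=
      ((hks.contDiffAt (hV.mem_nhds hw2)).differentiableAt (by simp)).hasFDerivAt
    have h3 := hkd.comp (r w) hjd
    have h4 : k ∘ j =ᶠ[𝓝 (r w)] j := by
      filter_upwards [hw1] with a ha
      simp [hk, ha]
    have h5 := h3.unique (hjd.congr_of_eventuallyEq h4)
    ext v
    have h6 : P (k w) (θ (k w) v) ∈ (fderiv ℝ j (r w)).toLinearMap.range := by
      rw [← hjP _ (hrA hwV)]
      exact ⟨_, rfl⟩
    obtain ⟨b, hb⟩ := h6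
    have h7 : fderiv ℝ k (k w) (fderiv ℝ j (r w) b) = fderiv ℝ j (r w) b :=
      congrArg (fun T : E →L[ℝ] F => T b) h5
    have h8 : P (k w) (θ (k w) v) = fderiv ℝ j (r w) b := hb.symm
    simp [hZ, h8, h7]
  obtain ⟨K, s, hs, hK⟩ :=
    ((hZs.contDiffAt (hWo.mem_nhds hW₀)).of_le (m := 1) (by simp)).exists_lipschitzOnWith
  have hZb : ∀ᶠ w in 𝓝 (j a₀), ‖Z w‖ ≤ K * ‖w - k w‖ := by
    have hkc : ContinuousAt k (j a₀) := (hks.contDiffAt (hV.mem_nhds hjV)).continuousAt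
    have h2 : ∀ᶠ w in 𝓝 (j a₀), k w ∈ s := hkc.eventually (by rw [hk₀]; exact hs)
    filter_upwards [hZ0, h2, hs] with w h0 h1 h2
    have := hK.dist_le_mul _ h2 _ h1
    rwa [h0, dist_zero_right, dist_eq_norm] at this
  have huc : ContinuousAt u x₀ := (hu.contDiffAt (hB.mem_nhds hx₀)).continuousAt
  have hub : ∀ᶠ x in 𝓝 x₀, ‖fderiv ℝ u x‖ ≤ ‖fderiv ℝ u x₀‖ + 1 := by
    have := ((hu.continuousOn_fderiv_of_isOpen hB (by simp)).continuousAt (hB.mem_nhds hx₀)).norm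
    exact (this.eventually (gt_mem_nhds (lt_add_one _))).mono fun x hx => le_of_lt hx
  have huW : ∀ᶠ x in 𝓝 x₀, u x ∈ W := huc.eventually (by rw [hux₀]; exact hWo.mem_nhds hW₀)
  have huZ : ∀ᶠ x in 𝓝 x₀, ‖Z (u x)‖ ≤ K * ‖u x - k (u x)‖ := huc.eventually (by rwa [hux₀])
  have huB : ∀ᶠ x in 𝓝 x₀, x ∈ B := hB.mem_nhds hx₀
  obtain ⟨ε, hε, hball⟩ := Metric.eventually_nhds_iff_ball.1
    (hub.and (huB.and (huZ.and huW)))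
  filter_upwards [Metric.ball_mem_nhds x₀ hε] with x hx
  have key := eq_zero_of_norm_fderiv_le (D := fun x => u x - k (u x))
    (D' := fun x => Z (u x) ∘L fderiv ℝ u x) (convex_ball x₀ ε)
    (C := K * (‖fderiv ℝ u x₀‖ + 1)) (fun y hy => ?_) (fun y hy => ?_)
    (Metric.mem_ball_self hε) hx (by simp [hux₀, hk₀])
  · exact (sub_eq_zero.1 key).symm
  · obtain ⟨-, hyB, -, hyW⟩ := hball y hy
    have hud : HasFDerivAt u (fderiv ℝ u y) y :=
      ((hu.contDiffAt (hB.mem_nhds hyB)).differentiableAt (by simp)).hasFDerivAt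
    have hkd : HasFDerivAt k (fderiv ℝ k (u y)) (u y) :=
      ((hks.contDiffAt (hV.mem_nhds hyW.1)).differentiableAt (by simp)).hasFDerivAt
    refine (hud.sub (hkd.comp y hud)).congr_fderiv ?_
    ext v
    have := hPθ (u y) hyW.2 (hrank y hyB) _ (hu' y hyB v)
    simp [hZ, this]
  · obtain ⟨hy1, hyB, hy2, hyW⟩ := hball y hy
    calc ‖Z (u y) ∘L fderiv ℝ u y‖ ≤ ‖Z (u y)‖ * ‖fderiv ℝ u y‖ :=
          ContinuousLinearMap.opNorm_comp_le _ _
      _ ≤ (K * ‖u y - k (u y)‖) * (‖fderiv ℝ u x₀‖ + 1) := by gcongr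
      _ = _ := by ring

end EuclideanLift

/-! ### Smoothness of maps into a symplectic leaf. -/

section ManifoldLift

variable {E : Type*} [NormedAddCommGroup E] [NormedSpace ℝ E]
  {S : Type*} [TopologicalSpace S] [ChartedSpace E S]
  {F : Type*} [NormedAddCommGroup F] [NormedSpace ℝ F]
  {M : Type*} [TopologicalSpace M] [ChartedSpace F M]
  {G : Type*} [NormedAddCommGroup G] [NormedSpace ℝ G]
  {N : Type*} [TopologicalSpace N] [ChartedSpace G N]

theorem GlobalCoord.fderiv_comp_symm (c : GlobalCoord E S) (c' : GlobalCoord F M) {j : S → M} (hj : ContMDiff 𝓘(ℝ, E) 𝓘(ℝ, F) ∞ j)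
    {s : S} (hs : s ∈ c.e.source) (v : TangentSpace 𝓘(ℝ, E) s) :
    fderiv ℝ ((c'.toFun ∘ j) ∘ c.e.symm) (c.toFun s) (c.d s v) =
      c'.d (j s) (tangentMapAt E F j s v) := by
  rw [← c.tangentMapAt_eq_fderiv hs (c'.contMDiff.comp hj).contMDiffAt,
    PoissonStructure.tangentMapAt_comp c'.contMDiff hj]
  rfl

theorem GlobalCoord.injective_fderiv_comp_symm (c : GlobalCoord E S) (c' : GlobalCoord F M)
    {j : S → M} (hj : ContMDiff 𝓘(ℝ, E) 𝓘(ℝ, F) ∞ j) {s : S} (hs : s ∈ c.e.source)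
    (hs' : j s ∈ c'.e.source) (hinj : Function.Injective (tangentMapAt E F j s)) :
    Function.Injective (fderiv ℝ ((c'.toFun ∘ j) ∘ c.e.symm) (c.toFun s)) := by
  intro v w hvw
  obtain ⟨v, rfl⟩ := (c.d_bijective hs).2 v
  obtain ⟨w, rfl⟩ := (c.d_bijective hs).2 w
  rw [c.fderiv_comp_symm c' hj hs, c.fderiv_comp_symm c' hj hs] at hvw
  rw [hinj ((c'.d_bijective hs').1 hvw)]

variable [FiniteDimensional ℝ E] [T2Space S] [IsManifold 𝓘(ℝ, E) ∞ S]
  [FiniteDimensional ℝ F] [T2Space M] [IsManifold 𝓘(ℝ, F) ∞ M]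
  [FiniteDimensional ℝ G] [T2Space N] [IsManifold 𝓘(ℝ, G) ∞ N]

theorem exists_leftInverse_of_injective_tangentMapAt {j : S → M}
    (hj : ContMDiff 𝓘(ℝ, E) 𝓘(ℝ, F) ∞ j) (s₀ : S)
    (hinj : Function.Injective (tangentMapAt E F j s₀)) :
    ∃ (V : Set M) (r : M → S), IsOpen V ∧ j s₀ ∈ V ∧ ContMDiffOn 𝓘(ℝ, F) 𝓘(ℝ, E) ∞ r V ∧
      ∀ᶠ s in 𝓝 s₀, r (j s) = s := by
  obtain ⟨c, hc⟩ := GlobalCoord.exists_mem_source (E := E) s₀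
  obtain ⟨c', hc'⟩ := GlobalCoord.exists_mem_source (E := F) (j s₀)
  obtain ⟨V, r, hV, hjV, hr, hrA, hrj⟩ := exists_leftInverse_of_immersion c.e.open_target
    (c.contDiffOn_comp_symm_target (c'.contMDiff.comp hj)) (c.map_source hc)
    (c.injective_fderiv_comp_symm c' hj hc hc' hinj)
  refine ⟨c'.toFun ⁻¹' V, c.e.symm ∘ r ∘ c'.toFun, hV.preimage c'.contMDiff.continuous, ?_, ?_, ?_⟩
  · simpa [c.left_inv hc] using hjV
  · exact c.contMDiffOn_symm.comp (hr.contMDiffOn.comp c'.contMDiff.contMDiffOn fun x hx => hx)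
      fun x hx => hrA hx
  · filter_upwards [c.contMDiff.continuous.continuousAt.eventually hrj,
      c.e.open_source.mem_nhds hc] with s hs hs'
    simp only [Function.comp_apply, c.left_inv hs'] at hs ⊢
    rw [hs, c.left_inv hs']

/-- A smooth map which is tangent to the characteristic distribution and takes its values in a
symplectic leaf is smooth as a map into the leaf. -/
theorem exists_contMDiff_lift (π : PoissonStructure F M) {j : S → M}
    (hj : ContMDiff 𝓘(ℝ, E) 𝓘(ℝ, F) ∞ j) (hjinj : Function.Injective j)
    (hjinj' : ∀ s, Function.Injective (tangentMapAt E F j s))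
    (hjr : ∀ s, (π.sharp (j s)).range = (tangentMapAt E F j s).range)
    {g : N → M} (hg : ContMDiff 𝓘(ℝ, G) 𝓘(ℝ, F) ∞ g) (hgr : ∀ l, g l ∈ range j)
    (hgt : ∀ l v, tangentMapAt G F g l v ∈ (π.sharp (g l)).range) :
    ∃ q : N → S, (∀ l, j (q l) = g l) ∧ ContMDiff 𝓘(ℝ, G) 𝓘(ℝ, E) ∞ q := by
  -- The lift exists as a map of sets and is unique since `j` is injective, so near each point it
  -- must agree with the smooth local factorization; no prior continuity of `q` is needed.
  choose q hq using hgr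
  refine ⟨q, hq, fun l₀ => ?_⟩
  obtain ⟨cN, hcN⟩ := GlobalCoord.exists_mem_source (E := G) l₀
  obtain ⟨c, hc⟩ := GlobalCoord.exists_mem_source (E := E) (q l₀)
  obtain ⟨c', hc'⟩ := GlobalCoord.exists_mem_source (E := F) (g l₀)
  have hc'' : j (q l₀) ∈ c'.e.source := by rwa [hq]
  set J : E → F := (c'.toFun ∘ j) ∘ c.e.symm with hJ
  set A : Set E := c.e.target ∩ c.e.symm ⁻¹' (j ⁻¹' c'.e.source) with hA
  have hAo : IsOpen A :=
    c.e.isOpen_inter_preimage_symm (c'.e.open_source.preimage hj.continuous)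
  set u : G → F := (c'.toFun ∘ g) ∘ cN.e.symm with hu
  set B : Set G := cN.e.target ∩ cN.e.symm ⁻¹' (g ⁻¹' c'.e.source) with hB
  have hBo : IsOpen B :=
    cN.e.isOpen_inter_preimage_symm (c'.e.open_source.preimage hg.continuous)
  have hJs : ContDiffOn ℝ ∞ J c.e.target := c.contDiffOn_comp_symm_target (c'.contMDiff.comp hj)
  have hus : ContDiffOn ℝ ∞ u cN.e.target := cN.contDiffOn_comp_symm_target (c'.contMDiff.comp hg)
  have hJa : ∀ s ∈ c.e.source, J (c.toFun s) = c'.toFun (j s) := fun s hs => by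
    simp [hJ, c.left_inv hs]
  have hJr : ∀ s ∈ c.e.source, j s ∈ c'.e.source →
      (c'.tensor π (J (c.toFun s))).toLinearMap.range =
        (fderiv ℝ J (c.toFun s)).toLinearMap.range := fun s hs hs' => by
    rw [hJa s hs, c'.range_tensor π hs', hjr]
    ext v
    constructor
    · rintro ⟨_, ⟨w, rfl⟩, rfl⟩
      exact ⟨c.d s w, c.fderiv_comp_symm c' hj hs w⟩
    · rintro ⟨w, rfl⟩
      obtain ⟨w, rfl⟩ := (c.d_bijective hs).2 w
      exact ⟨_, ⟨w, rfl⟩, (c.fderiv_comp_symm c' hj hs w).symm⟩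
  have hua : ∀ l ∈ cN.e.source, u (cN.toFun l) = c'.toFun (g l) := fun l hl => by
    simp [hu, cN.left_inv hl]
  -- Along `g` the rank is the dimension of the leaf, which gives the rank bound of
  -- `exists_lift_of_tangent`.
  have hfr : ∀ l, Module.finrank ℝ (π.sharp (g l)).range = Module.finrank ℝ E := fun l => by
    rw [← hq l, hjr]
    exact LinearMap.finrank_range_of_inj (hjinj' _)
  obtain ⟨V, r, hV, hVu, hr, hrA, hev⟩ := exists_lift_of_tangent c'.e.open_target
    (c'.contDiffOn_tensor π) hAo (hJs.mono inter_subset_left)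
    (fun a ha => c'.map_source ha.2)
    (a₀ := c.toFun (q l₀)) ⟨c.map_source hc, by simpa [c.left_inv hc] using hc''⟩
    (c.injective_fderiv_comp_symm c' hj hc hc'' (hjinj' _))
    (fun a ha => by
      have := hJr _ (c.e.map_target ha.1) ha.2
      rwa [c.right_inv ha.1] at this)
    hBo (hus.mono inter_subset_left)
    (fun x hx v => by
      have hl := cN.e.map_target hx.1
      obtain ⟨v, rfl⟩ := (cN.d_bijective hl).2 v
      have h1 : fderiv ℝ u _ _ = _ := cN.fderiv_comp_symm c' hg hl v
      have h2 := hua _ hl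
      rw [cN.right_inv hx.1] at h1 h2
      rw [h1, h2, c'.range_tensor π hx.2]
      exact Submodule.mem_map_of_mem (hgt _ _))
    (fun x hx => by
      have hl := cN.e.map_target hx.1
      have h2 := hua _ hl
      rw [cN.right_inv hx.1] at h2
      rw [h2, hJa _ hc, c'.finrank_range_tensor π hx.2, c'.finrank_range_tensor π hc'', hfr, hq, hfr])
    (x₀ := cN.toFun l₀) ⟨cN.map_source hcN, by simpa [cN.left_inv hcN] using hc'⟩
    (by rw [hua _ hcN, hJa _ hc, hq])
  rw [hua _ hcN] at hVu
  have hlift : q =ᶠ[𝓝 l₀] c.e.symm ∘ r ∘ c'.toFun ∘ g := by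
    filter_upwards [cN.contMDiff.continuous.continuousAt.eventually hev,
      cN.e.open_source.mem_nhds hcN, hg.continuous.continuousAt (c'.e.open_source.mem_nhds hc'),
      (c'.contMDiff.comp hg).continuous.continuousAt (hV.mem_nhds hVu)] with l h1 h2 h3 h4
    rw [hua _ h2] at h1
    have h5 : j (c.e.symm (r (c'.toFun (g l)))) ∈ c'.e.source := (hrA h4).2
    apply hjinj
    rw [hq]
    refine (c'.e.injOn h5 h3 ?_).symm
    rw [c'.eqOn _ h5, c'.eqOn _ h3]
    exact h1
  refine ContMDiffAt.congr_of_eventuallyEq ?_ hlift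
  have h1 : ContMDiffAt 𝓘(ℝ, G) 𝓘(ℝ, F) ∞ (c'.toFun ∘ g) l₀ := (c'.contMDiff.comp hg).contMDiffAt
  have h2 : ContMDiffAt 𝓘(ℝ, F) 𝓘(ℝ, E) ∞ r (c'.toFun (g l₀)) :=
    (hr.contDiffAt (hV.mem_nhds hVu)).contMDiffAt
  have h3 : ContMDiffAt 𝓘(ℝ, E) 𝓘(ℝ, E) ∞ c.e.symm (r (c'.toFun (g l₀))) :=
    c.contMDiffOn_symm.contMDiffAt (c.e.open_target.mem_nhds (hrA hVu).1)
  exact h3.comp l₀ (h2.comp l₀ h1)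

end ManifoldLift

/-! ### Restricting a Poisson structure to an immersed submanifold. -/

section Restriction

/-- A smooth map on an open set agrees near any point with a globally smooth map. -/
theorem exists_contMDiff_eventuallyEq {E : Type*} [NormedAddCommGroup E] [NormedSpace ℝ E]
    [FiniteDimensional ℝ E] {M : Type*} [TopologicalSpace M] [ChartedSpace E M] [T2Space M]
    [IsManifold 𝓘(ℝ, E) ∞ M] {f : M → ℝ} {V : Set M} (hV : IsOpen V)
    (hf : ContMDiffOn 𝓘(ℝ, E) 𝓘(ℝ, ℝ) ∞ f V) {x₀ : M} (hx₀ : x₀ ∈ V) :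
    ∃ g : M → ℝ, ContMDiff 𝓘(ℝ, E) 𝓘(ℝ, ℝ) ∞ g ∧ g =ᶠ[𝓝 x₀] f := by
  obtain ⟨b, -, hb⟩ := (SmoothBumpFunction.nhds_basis_tsupport (I := 𝓘(ℝ, E)) x₀).mem_iff.1
    (hV.mem_nhds hx₀)
  refine ⟨fun x => b x • f x, contMDiff_of_tsupport fun x hx => ?_, ?_⟩
  · have : x ∈ V := hb (tsupport_smul_subset_left _ _ hx)
    exact b.contMDiff.contMDiffAt.smul (hf.contMDiffAt (hV.mem_nhds this))
  · filter_upwards [b.eventuallyEq_one] with x hx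
    simp [hx]

variable {F : Type*} [NormedAddCommGroup F] [NormedSpace ℝ F]
  {M : Type*} [TopologicalSpace M] [ChartedSpace F M]
  {G : Type*} [NormedAddCommGroup G] [NormedSpace ℝ G]
  {N : Type*} [TopologicalSpace N] [ChartedSpace G N]

theorem dAt_comp {g : M → ℝ} {i : N → M} (hg : ContMDiff 𝓘(ℝ, F) 𝓘(ℝ, ℝ) ∞ g)
    (hi : ContMDiff 𝓘(ℝ, G) 𝓘(ℝ, F) ∞ i) (n : N) :
    dAt G (g ∘ i) n = dAt F g (i n) ∘ₗ tangentMapAt G F i n := by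
  ext v
  exact PoissonStructure.tangentMapAt_comp hg hi n v

theorem dAt_congr {f g : N → ℝ} {n : N} (h : f =ᶠ[𝓝 n] g) : dAt G f n = dAt G g n := by
  ext v
  exact congrArg (fun A : G →L[ℝ] ℝ => A v) h.mfderiv_eq

/-- Brackets on `N` can be computed on `M` from any local extensions; this is how smoothness and the
Jacobi identity pass to `N`. -/
theorem bracketOf_eq_of_eventuallyEq {π : PoissonStructure F M} {i : N → M}
    (hi : ContMDiff 𝓘(ℝ, G) 𝓘(ℝ, F) ∞ i)
    {s : ∀ n : N, Module.Dual ℝ (TangentSpace 𝓘(ℝ, G) n) →ₗ[ℝ] TangentSpace 𝓘(ℝ, G) n}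
    (hs : ∀ (n : N) (ξ : Module.Dual ℝ (TangentSpace 𝓘(ℝ, F) (i n))),
      tangentMapAt G F i n (s n (ξ ∘ₗ tangentMapAt G F i n)) = π.sharp (i n) ξ)
    {f g : N → ℝ} {f' g' : M → ℝ} (hf' : ContMDiff 𝓘(ℝ, F) 𝓘(ℝ, ℝ) ∞ f')
    (hg' : ContMDiff 𝓘(ℝ, F) 𝓘(ℝ, ℝ) ∞ g') {n : N} (hf : f' ∘ i =ᶠ[𝓝 n] f)
    (hg : g' ∘ i =ᶠ[𝓝 n] g) : bracketOf s f g n = bracketOf π.sharp f' g' (i n) := by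
  rw [bracketOf, bracketOf, ← dAt_congr hf, ← dAt_congr hg, dAt_comp hf' hi, dAt_comp hg' hi,
    LinearMap.comp_apply, hs]

/-- A Poisson structure whose characteristic distribution is tangent to an immersed submanifold
restricts to this submanifold. -/
theorem PoissonStructure.exists_restriction [FiniteDimensional ℝ F] [T2Space M]
    [IsManifold 𝓘(ℝ, F) ∞ M] [FiniteDimensional ℝ G] [T2Space N] [IsManifold 𝓘(ℝ, G) ∞ N]
    (π : PoissonStructure F M) {i : N → M}
    (hi : ContMDiff 𝓘(ℝ, G) 𝓘(ℝ, F) ∞ i) (hinj : ∀ n, Function.Injective (tangentMapAt G F i n))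
    (hr : ∀ n, (π.sharp (i n)).range ≤ (tangentMapAt G F i n).range) :
    ∃ πN : PoissonStructure G N, πN.IsPoissonMap π i := by
  choose L hL using fun n => LinearMap.exists_leftInverse_of_injective (tangentMapAt G F i n)
    (LinearMap.ker_eq_bot.2 (hinj n))
  have hL' : ∀ n v, L n (tangentMapAt G F i n v) = v := fun n v => LinearMap.congr_fun (hL n) v
  set s : ∀ n : N, Module.Dual ℝ (TangentSpace 𝓘(ℝ, G) n) →ₗ[ℝ] TangentSpace 𝓘(ℝ, G) n :=
    fun n => L n ∘ₗ π.sharp (i n) ∘ₗ (L n).dualMap with hs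
  have hmap : ∀ (n : N) (ξ : Module.Dual ℝ (TangentSpace 𝓘(ℝ, F) (i n))),
      tangentMapAt G F i n (s n (ξ ∘ₗ tangentMapAt G F i n)) = π.sharp (i n) ξ := by
    intro n ξ
    set ζ := (ξ ∘ₗ tangentMapAt G F i n) ∘ₗ L n with hζ
    -- `ζ` and `ξ` agree on `im i_*`, which contains `im π^♯`; by skewness `π^♯` does not see their
    -- difference. Hence the choice of `L` is immaterial.
    have h1 : π.sharp (i n) ζ = π.sharp (i n) ξ := by
      rw [← sub_eq_zero, ← map_sub, ← Module.forall_dual_apply_eq_zero_iff ℝ]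
      intro η
      rw [π.skew, neg_eq_zero]
      obtain ⟨v, hv⟩ := hr n ⟨η, rfl⟩
      rw [← hv]
      simp [hζ, hL']
    obtain ⟨v, hv⟩ := hr n ⟨ζ, rfl⟩
    change tangentMapAt G F i n (L n (π.sharp (i n) ζ)) = _
    rw [← hv, hL', hv, h1]
  have hext : ∀ (f : N → ℝ), ContMDiff 𝓘(ℝ, G) 𝓘(ℝ, ℝ) ∞ f → ∀ n₀, ∃ f' : M → ℝ,
      ContMDiff 𝓘(ℝ, F) 𝓘(ℝ, ℝ) ∞ f' ∧ f' ∘ i =ᶠ[𝓝 n₀] f := by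
    intro f hf n₀
    obtain ⟨V, r, hV, hiV, hrs, hri⟩ := exists_leftInverse_of_injective_tangentMapAt hi n₀ (hinj n₀)
    obtain ⟨f', hf', hff'⟩ := exists_contMDiff_eventuallyEq hV (hf.comp_contMDiffOn hrs) hiV
    refine ⟨f', hf', ?_⟩
    filter_upwards [hi.continuous.continuousAt.eventually hff', hri] with n h1 h2
    simp only [Function.comp_apply] at h1 ⊢
    rw [h1, h2]
  have hbr : ∀ {f g : N → ℝ} {f' g' : M → ℝ}, ContMDiff 𝓘(ℝ, F) 𝓘(ℝ, ℝ) ∞ f' →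
      ContMDiff 𝓘(ℝ, F) 𝓘(ℝ, ℝ) ∞ g' → ∀ {n : N}, f' ∘ i =ᶠ[𝓝 n] f → g' ∘ i =ᶠ[𝓝 n] g →
      bracketOf π.sharp f' g' ∘ i =ᶠ[𝓝 n] bracketOf s f g := by
    intro f g f' g' hf' hg' n hf hg
    filter_upwards [hf.eventually_nhds, hg.eventually_nhds] with m hm hm'
    exact (bracketOf_eq_of_eventuallyEq hi hmap hf' hg' hm hm').symm
  refine ⟨⟨s, fun n ξ η => ?_, fun f g hf hg n => ?_, fun f g h hf hg hh n => ?_⟩, hi, hmap⟩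
  · exact π.skew (i n) (ξ ∘ₗ L n) (η ∘ₗ L n)
  · obtain ⟨f', hf', hff⟩ := hext f hf n
    obtain ⟨g', hg', hgg⟩ := hext g hg n
    exact ((π.smooth _ _ hf' hg').comp hi).contMDiffAt.congr_of_eventuallyEq
      (hbr hf' hg' hff hgg).symm
  · obtain ⟨f', hf', hff⟩ := hext f hf n
    obtain ⟨g', hg', hgg⟩ := hext g hg n
    obtain ⟨h', hh', hhh⟩ := hext h hh n
    have e1 := (hbr hf' (π.smooth _ _ hg' hh') hff (hbr hg' hh' hgg hhh)).eq_of_nhds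
    have e2 := (hbr hg' (π.smooth _ _ hh' hf') hgg (hbr hh' hf' hhh hff)).eq_of_nhds
    have e3 := (hbr hh' (π.smooth _ _ hf' hg') hhh (hbr hf' hg' hff hgg)).eq_of_nhds
    rw [← e1, ← e2, ← e3]
    exact π.jacobi _ _ _ hf' hg' hh' (i n)

end Restriction

/-! ### Charts of the fibre product. -/

section Slices

/-- A subspace of a manifold which is locally parametrized by smooth maps, with inverses that extend to
smooth maps on the ambient manifold, is a manifold, immersed by the inclusion. -/
theorem exists_isManifold_of_slices {EN : Type*} [NormedAddCommGroup EN] [NormedSpace ℝ EN]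
    {HN : Type*} [TopologicalSpace HN] {I : ModelWithCorners ℝ EN HN}
    {N : Type*} [TopologicalSpace N] [ChartedSpace HN N] {P : N → Prop}
    {H : Type*} [NormedAddCommGroup H] [NormedSpace ℝ H]
    (hP : ∀ q : Subtype P, ∃ (e : OpenPartialHomeomorph (Subtype P) H) (h : N → H), q ∈ e.source ∧
      ContMDiff I 𝓘(ℝ, H) ∞ h ∧ (∀ q, e q = h q) ∧
      ContMDiffOn 𝓘(ℝ, H) I ∞ (fun y => (e.symm y : N)) e.target) :
    ∃ (_ : ChartedSpace H (Subtype P)) (_ : IsManifold 𝓘(ℝ, H) ∞ (Subtype P)),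
      ContMDiff 𝓘(ℝ, H) I ∞ (Subtype.val : Subtype P → N) ∧
      ∀ q : Subtype P, Function.Injective (mfderiv 𝓘(ℝ, H) I (Subtype.val : Subtype P → N) q) := by
  choose e h hq hh heh hs using hP
  let cs : ChartedSpace H (Subtype P) :=
    { atlas := range e
      chartAt := e
      mem_chart_source := hq
      chart_mem_atlas := fun q => mem_range_self q }
  have ms : IsManifold 𝓘(ℝ, H) ∞ (Subtype P) := by
    refine isManifold_of_contDiffOn _ _ _ ?_
    rintro _ _ ⟨q, rfl⟩ ⟨q', rfl⟩
    rw [← contMDiffOn_iff_contDiffOn]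
    have h1 : ContMDiffOn 𝓘(ℝ, H) 𝓘(ℝ, H) ∞ (fun y => h q' ((e q).symm y)) (e q).target :=
      (hh q').comp_contMDiffOn (hs q)
    refine (h1.mono ?_).congr ?_
    · intro y hy
      exact hy.1.1
    · intro y _
      exact heh q' _
  have hval : ContMDiff 𝓘(ℝ, H) I ∞ (Subtype.val : Subtype P → N) := by
    intro q
    have h1 : ContMDiffAt 𝓘(ℝ, H) 𝓘(ℝ, H) ∞ (e q) q :=
      (contMDiffOn_chart (I := 𝓘(ℝ, H)) (x := q)).contMDiffAt ((e q).open_source.mem_nhds (hq q))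
    have h2 : ContMDiffAt 𝓘(ℝ, H) I ∞ (fun y => ((e q).symm y : N)) (e q q) :=
      (hs q).contMDiffAt ((e q).open_target.mem_nhds ((e q).map_source (hq q)))
    refine (h2.comp q h1).congr_of_eventuallyEq ?_
    filter_upwards [(e q).open_source.mem_nhds (hq q)] with x hx
    simp [(e q).left_inv hx]
  refine ⟨cs, ms, hval, fun q => ?_⟩
  have h1 : Function.Injective (mfderiv 𝓘(ℝ, H) 𝓘(ℝ, H) (e q) q) :=
    (mdifferentiable_chart (I := 𝓘(ℝ, H)) q).mfderiv_injective (hq q)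
  -- The chart factors through the inclusion, so injectivity of its derivative passes to the
  -- inclusion.
  have h2 : (e q : Subtype P → H) = h q ∘ Subtype.val := funext (heh q)
  rw [h2, mfderiv_comp q ((hh q).mdifferentiable (by simp) _) (hval.mdifferentiable (by simp) q)] at h1
  exact Function.Injective.of_comp (f := mfderiv I 𝓘(ℝ, H) (h q) q) h1

variable {ES : Type*} [NormedAddCommGroup ES] [NormedSpace ℝ ES] [FiniteDimensional ℝ ES]
  {S : Type*} [TopologicalSpace S] [ChartedSpace ES S] [T2Space S] [IsManifold 𝓘(ℝ, ES) ∞ S]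
  {EM : Type*} [NormedAddCommGroup EM] [NormedSpace ℝ EM] [FiniteDimensional ℝ EM]
  {M : Type*} [TopologicalSpace M] [ChartedSpace EM M] [T2Space M] [IsManifold 𝓘(ℝ, EM) ∞ M]
  {EX : Type*} [NormedAddCommGroup EX] [NormedSpace ℝ EX] [FiniteDimensional ℝ EX]
  {X : Type*} [TopologicalSpace X] [ChartedSpace EX X] [T2Space X] [IsManifold 𝓘(ℝ, EX) ∞ X]

/-- Charts of the fibre product of a smooth map and a submersion. -/
theorem exists_pullback_chart {j : S → M} {p : X → M} (hj : ContMDiff 𝓘(ℝ, ES) 𝓘(ℝ, EM) ∞ j)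
    (hp : ContMDiff 𝓘(ℝ, EX) 𝓘(ℝ, EM) ∞ p)
    (hsurj : ∀ z, Function.Surjective (tangentMapAt EX EM p z)) {k : ℕ}
    (hk : k + Module.finrank ℝ EM = Module.finrank ℝ ES + Module.finrank ℝ EX)
    (q₀ : Function.Pullback j p) :
    ∃ (e : OpenPartialHomeomorph (Function.Pullback j p) (EuclideanSpace ℝ (Fin k)))
      (h : S × X → EuclideanSpace ℝ (Fin k)), q₀ ∈ e.source ∧
      ContMDiff (𝓘(ℝ, ES).prod 𝓘(ℝ, EX)) 𝓘(ℝ, EuclideanSpace ℝ (Fin k)) ∞ h ∧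
      (∀ q : Function.Pullback j p, e q = h q.1) ∧
      ContMDiffOn 𝓘(ℝ, EuclideanSpace ℝ (Fin k)) (𝓘(ℝ, ES).prod 𝓘(ℝ, EX)) ∞
        (fun y => (e.symm y).1) e.target := by
  obtain ⟨c, hc⟩ := GlobalCoord.exists_mem_source (E := ES) q₀.1.1
  obtain ⟨cX, hcX⟩ := GlobalCoord.exists_mem_source (E := EX) q₀.1.2
  obtain ⟨cM, hcM⟩ := GlobalCoord.exists_mem_source (E := EM) (p q₀.1.2)
  set g : EX → EM := (cM.toFun ∘ p) ∘ cX.e.symm with hg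
  have hgs : ContDiffOn ℝ ∞ g cX.e.target := cX.contDiffOn_comp_symm_target (cM.contMDiff.comp hp)
  set Ω : Set EX := cX.e.target ∩ cX.e.symm ⁻¹' (p ⁻¹' cM.e.source) with hΩ
  have hΩo : IsOpen Ω :=
    cX.e.isOpen_inter_preimage_symm (cM.e.open_source.preimage hp.continuous)
  have hu₀ : cX.toFun q₀.1.2 ∈ Ω := ⟨cX.map_source hcX, by simpa [cX.left_inv hcX] using hcM⟩
  have hgsurj : Function.Surjective (fderiv ℝ g (cX.toFun q₀.1.2)) := fun y => by
    obtain ⟨v', rfl⟩ := (cM.d_bijective hcM).2 y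
    obtain ⟨v, rfl⟩ := hsurj _ v'
    exact ⟨cX.d _ v, cX.fderiv_comp_symm cM hp hcX v⟩
  obtain ⟨K, W, Φ, hK, hΦ₀, hΦΩ, hΦ, hΦs⟩ : ∃ (K : Submodule ℝ EX) (W : EX →L[ℝ] K)
      (Φ : OpenPartialHomeomorph EX (EM × K)),
      Module.finrank ℝ EM + Module.finrank ℝ K = Module.finrank ℝ EX ∧
      cX.toFun q₀.1.2 ∈ Φ.source ∧ Φ.source ⊆ Ω ∧
      (∀ u, Φ u = (g u, W u)) ∧ ContDiffOn ℝ ∞ Φ.symm Φ.target := by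
    refine ⟨_, (exists_submersion_coordinates hΩo (hgs.mono inter_subset_left) hu₀ hgsurj).imp
      fun W => ?_⟩
    rintro ⟨Φ, h⟩
    refine ⟨Φ, ?_, h⟩
    rw [← LinearMap.finrank_range_add_finrank_ker (fderiv ℝ g (cX.toFun q₀.1.2)).toLinearMap,
      LinearMap.range_eq_top.2 hgsurj, finrank_top]
  obtain ⟨L⟩ : Nonempty ((ES × K) ≃L[ℝ] EuclideanSpace ℝ (Fin k)) := by
    refine FiniteDimensional.nonempty_continuousLinearEquiv_of_finrank_eq ?_
    rw [Module.finrank_prod, finrank_euclideanSpace_fin]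
    omega
  -- A point of the fibre product is recorded by its coordinates in `S` and the component `W` along
  -- the fibre of `p`. Its point in `X` is recovered as `ζ`: the submersion coordinates `(g, W)` are
  -- inverted at `(j σ, W)`.
  set σ : EuclideanSpace ℝ (Fin k) → S := fun y => c.e.symm (L.symm y).1 with hσ
  set τ : EuclideanSpace ℝ (Fin k) → EM × K := fun y => (cM.toFun (j (σ y)), (L.symm y).2) with hτ
  set ζ : EuclideanSpace ℝ (Fin k) → X := fun y => cX.e.symm (Φ.symm (τ y)) with hζ
  set h : S × X → EuclideanSpace ℝ (Fin k) := fun q => L (c.toFun q.1, W (cX.toFun q.2)) with hh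
  have hhs : ContMDiff (𝓘(ℝ, ES).prod 𝓘(ℝ, EX)) 𝓘(ℝ, EuclideanSpace ℝ (Fin k)) ∞ h :=
    L.contDiff.contMDiff.comp ((c.contMDiff.comp contMDiff_fst).prodMk_space
      (W.contMDiff.comp (cX.contMDiff.comp contMDiff_snd)))
  set D : Set (EuclideanSpace ℝ (Fin k)) :=
    {y | (L.symm y).1 ∈ c.e.target ∧ j (σ y) ∈ cM.e.source ∧ τ y ∈ Φ.target} with hD
  set T : Set (EuclideanSpace ℝ (Fin k)) := {y | (L.symm y).1 ∈ c.e.target} with hT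
  have hTo : IsOpen T := c.e.open_target.preimage (continuous_fst.comp L.symm.continuous)
  have hfst : ContMDiff 𝓘(ℝ, EuclideanSpace ℝ (Fin k)) 𝓘(ℝ, ES) ∞
      (fun y => (L.symm y).1) := (contDiff_fst.comp L.symm.contDiff).contMDiff
  have hσs : ContMDiffOn 𝓘(ℝ, EuclideanSpace ℝ (Fin k)) 𝓘(ℝ, ES) ∞ σ T :=
    c.contMDiffOn_symm.comp hfst.contMDiffOn fun y hy => hy
  have hτs : ContMDiffOn 𝓘(ℝ, EuclideanSpace ℝ (Fin k)) 𝓘(ℝ, EM × K) ∞ τ T :=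
    ((cM.contMDiff.comp hj).comp_contMDiffOn hσs).prodMk_space
      (contDiff_snd.comp L.symm.contDiff).contMDiff.contMDiffOn
  have hDo : IsOpen D := by
    have h1 := hσs.continuousOn.isOpen_inter_preimage hTo
      (cM.e.open_source.preimage hj.continuous)
    have h2 := hτs.continuousOn.isOpen_inter_preimage hTo Φ.open_target
    convert h1.inter h2 using 1
    ext y
    simp only [hD, hT, mem_ofPred_eq, mem_inter_iff, mem_preimage]
    tauto
  have hDT : D ⊆ T := fun y hy => hy.1
  have hζs : ContMDiffOn 𝓘(ℝ, EuclideanSpace ℝ (Fin k)) 𝓘(ℝ, EX) ∞ ζ D :=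
    cX.contMDiffOn_symm.comp (hΦs.contMDiffOn.comp (hτs.mono hDT) fun y hy => hy.2.2)
      fun y hy => (hΦΩ (Φ.map_target hy.2.2)).1
  have hjp : ∀ y ∈ D, j (σ y) = p (ζ y) := by
    intro y hy
    have h1 := hΦΩ (Φ.map_target hy.2.2)
    have h2 : g (Φ.symm (τ y)) = cM.toFun (j (σ y)) := by
      have := congrArg Prod.fst (Φ.right_inv hy.2.2)
      rwa [hΦ] at this
    refine cM.e.injOn hy.2.1 h1.2 ?_
    rw [cM.eqOn _ hy.2.1, cM.eqOn (p (cX.e.symm (Φ.symm (τ y)))) h1.2]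
    exact h2.symm
  classical
  set inv : EuclideanSpace ℝ (Fin k) → Function.Pullback j p := fun y =>
    -- `q₀` is a filler: the condition holds on all of `D`.
    if hy : j (σ y) = p (ζ y) then ⟨(σ y, ζ y), hy⟩ else q₀ with hinv
  have hinvD : ∀ y ∈ D, (inv y).1 = (σ y, ζ y) := fun y hy => by simp [hinv, hjp y hy]
  have hτq : ∀ q : Function.Pullback j p, q.1.1 ∈ c.e.source → q.1.2 ∈ cX.e.source →
      σ (h q.1) = q.1.1 ∧ τ (h q.1) = Φ (cX.toFun q.1.2) := by
    intro q hq1 hq2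
    have h1 : σ (h q.1) = q.1.1 := by simp [hσ, hh, c.left_inv hq1]
    refine ⟨h1, ?_⟩
    simp only [hτ]
    rw [h1, q.2, hΦ]
    simp [hg, hh, cX.left_inv hq2]
  set U : Set (Function.Pullback j p) := {q | q.1.1 ∈ c.e.source ∧ q.1.2 ∈ cX.e.source ∧
    cX.toFun q.1.2 ∈ Φ.source} with hU
  have hval : ContMDiffOn 𝓘(ℝ, EuclideanSpace ℝ (Fin k)) (𝓘(ℝ, ES).prod 𝓘(ℝ, EX)) ∞
      (fun y => (inv y).1) D := ((hσs.mono hDT).prodMk hζs).congr hinvD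
  refine ⟨{ toFun := fun q => h q.1
            invFun := inv
            source := U
            target := D
            map_source' := ?_
            map_target' := ?_
            left_inv' := ?_
            right_inv' := ?_
            open_source := ?_
            open_target := hDo
            continuousOn_toFun := (hhs.continuous.comp continuous_subtype_val).continuousOn
            continuousOn_invFun := Topology.IsInducing.subtypeVal.continuousOn_iff.2
              hval.continuousOn }, h, ⟨hc, hcX, hΦ₀⟩, hhs, fun q => rfl, hval⟩
  · rintro q ⟨h1, h2, h3⟩
    obtain ⟨h4, h5⟩ := hτq q h1 h2
    refine ⟨?_, ?_, ?_⟩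
    · simpa [hh] using c.map_source h1
    · rw [h4, q.2]
      have := (hΦΩ h3).2
      simpa [cX.left_inv h2] using this
    · rw [h5]; exact Φ.map_source h3
  · intro y hy
    have h1 := hΦΩ (Φ.map_target hy.2.2)
    simp only [hU, mem_ofPred_eq, hinvD y hy]
    refine ⟨c.e.map_target hy.1, cX.e.map_target h1.1, ?_⟩
    rw [cX.right_inv h1.1]
    exact Φ.map_target hy.2.2
  · rintro q ⟨h1, h2, h3⟩
    obtain ⟨h4, h5⟩ := hτq q h1 h2
    have h6 : ζ (h q.1) = q.1.2 := by
      simp only [hζ]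
      rw [h5, Φ.left_inv h3, cX.left_inv h2]
    have h7 : j (σ (h q.1)) = p (ζ (h q.1)) := by rw [h4, h6, q.2]
    apply Subtype.ext
    simp only [hinv, dif_pos h7]
    exact Prod.ext h4 h6
  · intro y hy
    have h1 := hΦΩ (Φ.map_target hy.2.2)
    have h2 := congrArg Prod.snd (Φ.right_inv hy.2.2)
    rw [hΦ] at h2
    simp only [hinvD y hy, hh, hζ, hσ]
    rw [cX.right_inv h1.1, c.right_inv hy.1]
    have h3 : ((L.symm y).1, W (Φ.symm (τ y))) = L.symm y := Prod.ext rfl h2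
    rw [h3, L.apply_symm_apply]
  · refine (c.e.open_source.preimage (continuous_fst.comp continuous_subtype_val)).inter
      (IsOpen.inter (cX.e.open_source.preimage (continuous_snd.comp continuous_subtype_val)) ?_)
    exact Φ.open_source.preimage
      (cX.contMDiff.continuous.comp (continuous_snd.comp continuous_subtype_val))

end Slices

/-! ### Poisson maps to symplectic manifolds. -/

section Coupling

/-- A linear Poisson map to a symplectic vector space is surjective. -/
theorem surjective_of_surjective_sharp {T T' : Type*} [AddCommGroup T] [Module ℝ T]
    [AddCommGroup T'] [Module ℝ T'] {sharp : Module.Dual ℝ T →ₗ[ℝ] T}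
    {sharp' : Module.Dual ℝ T' →ₗ[ℝ] T'} {A : T →ₗ[ℝ] T'}
    (hA : ∀ ξ, A (sharp (ξ ∘ₗ A)) = sharp' ξ) (hs : Function.Surjective sharp') :
    Function.Surjective A := fun v => by
  obtain ⟨ξ, rfl⟩ := hs v
  exact ⟨_, hA ξ⟩

/-- The kernel of a linear Poisson map to a symplectic vector space is a Poisson transversal. -/
theorem isCompl_ker_map_sharp {T T' : Type*} [AddCommGroup T] [Module ℝ T]
    [AddCommGroup T'] [Module ℝ T'] {sharp : Module.Dual ℝ T →ₗ[ℝ] T}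
    {sharp' : Module.Dual ℝ T' →ₗ[ℝ] T'} {A : T →ₗ[ℝ] T'}
    (hA : ∀ ξ, A (sharp (ξ ∘ₗ A)) = sharp' ξ) (hs : Function.Bijective sharp') :
    IsCompl A.ker (A.ker.dualAnnihilator.map sharp) := by
  -- The annihilator of `ker A` is `im A^*`, and `A ∘ sharp ∘ A^* = sharp'` is bijective, so `sharp
  -- ∘ A^*` is, up to `sharp'`, a linear section of `A`.
  rw [← LinearMap.range_dualMap_eq_dualAnnihilator_ker]
  constructor
  · rw [Submodule.disjoint_def]
    rintro _ hv ⟨_, ⟨ξ, rfl⟩, rfl⟩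
    have h1 : sharp' ξ = 0 := (hA ξ).symm.trans hv
    rw [(map_eq_zero_iff sharp' hs.1).1 h1, map_zero, map_zero]
  · rw [codisjoint_iff, eq_top_iff]
    intro v _
    obtain ⟨ξ, hξ⟩ := hs.2 (A v)
    rw [← sub_add_cancel v (sharp (A.dualMap ξ))]
    refine Submodule.add_mem_sup ?_ ⟨_, ⟨ξ, rfl⟩, rfl⟩
    rw [LinearMap.mem_ker, map_sub, ← hξ, ← hA ξ]
    exact sub_self _

namespace PoissonStructure

variable {G : Type*} [NormedAddCommGroup G] [NormedSpace ℝ G]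
  {N : Type*} [TopologicalSpace N] [ChartedSpace G N]
  {ES : Type*} [NormedAddCommGroup ES] [NormedSpace ℝ ES]
  {S : Type*} [TopologicalSpace S] [ChartedSpace ES S]
  {EX : Type*} [NormedAddCommGroup EX] [NormedSpace ℝ EX]
  {X : Type*} [TopologicalSpace X] [ChartedSpace EX X]
  {EM : Type*} [NormedAddCommGroup EM] [NormedSpace ℝ EM]
  {M : Type*} [TopologicalSpace M] [ChartedSpace EM M]
  {πN : PoissonStructure G N} {πS : PoissonStructure ES S} {πX : PoissonStructure EX X}
  {πM : PoissonStructure EM M} {q : N → S} {i : N → X} {p : X → M} {j : S → M}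

/-- A Poisson map to a symplectic manifold is a coupling Poisson submersion. -/
theorem IsPoissonMap.isCouplingPoissonSubmersion (hq : πN.IsPoissonMap πS q)
    (hS : πS.IsSymplectic) : πN.IsCouplingPoissonSubmersion πS q where
  toIsPoissonMap := hq
  surjective_tangentMap n := surjective_of_surjective_sharp (hq.map_sharp n) (hS (q n)).2
  coupling _ n _ := isCompl_ker_map_sharp (hq.map_sharp n) (hS (q n))

/-- The points `j (q n)` and `p (i n)` are equal but not definitionally, so vectors tangent at them
are compared in the model space `EM`. -/
theorem sharp_congr (π : PoissonStructure EM M) {m m' : M} (h : m = m') (η : Module.Dual ℝ EM) :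
    (π.sharp m η : EM) = π.sharp m' η := by
  subst h
  rfl

theorem tangentMapAt_apply_eq_of_comp_eq (hq : ContMDiff 𝓘(ℝ, G) 𝓘(ℝ, ES) ∞ q)
    (hj : ContMDiff 𝓘(ℝ, ES) 𝓘(ℝ, EM) ∞ j) (hi : ContMDiff 𝓘(ℝ, G) 𝓘(ℝ, EX) ∞ i)
    (hp : ContMDiff 𝓘(ℝ, EX) 𝓘(ℝ, EM) ∞ p) (h : ∀ n, j (q n) = p (i n)) (n : N)
    (v : TangentSpace 𝓘(ℝ, G) n) :
    (tangentMapAt ES EM j (q n) (tangentMapAt G ES q n v) : EM) =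
      tangentMapAt EX EM p (i n) (tangentMapAt G EX i n v) := by
  have h1 : ∀ f g : N → M, f = g → (tangentMapAt G EM f n v : EM) = tangentMapAt G EM g n v := by
    rintro f _ rfl
    rfl
  have h2 := h1 (j ∘ q) (p ∘ i) (funext h)
  rwa [tangentMapAt_comp hj hq, tangentMapAt_comp hp hi] at h2

/-- A smooth map which becomes Poisson after composition with a Poisson immersion is Poisson. -/
theorem IsPoissonMap.of_comp_eq (hq : ContMDiff 𝓘(ℝ, G) 𝓘(ℝ, ES) ∞ q)
    (hi : πN.IsPoissonMap πX i) (hp : πX.IsPoissonMap πM p) (hj : πS.IsPoissonMap πM j)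
    (hinj : ∀ s, Function.Injective (tangentMapAt ES EM j s)) (h : ∀ n, j (q n) = p (i n)) :
    πN.IsPoissonMap πS q := by
  refine ⟨hq, fun n ξ => ?_⟩
  -- Every covector on `S` is the pullback of one on `M`, so the identity can be tested after
  -- applying `j_*`.
  obtain ⟨η, rfl⟩ := LinearMap.dualMap_surjective_of_injective (hinj (q n)) ξ
  have hT := tangentMapAt_apply_eq_of_comp_eq hq hj.contMDiff hi.contMDiff hp.contMDiff h n
  apply hinj (q n)
  refine Eq.trans ?_ (hj.map_sharp (q n) η).symm
  refine (hT _).trans ?_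
  have h1 : ((tangentMapAt ES EM j (q n)).dualMap η ∘ₗ tangentMapAt G ES q n :
      Module.Dual ℝ (TangentSpace 𝓘(ℝ, G) n)) =
      ((η : Module.Dual ℝ EM) ∘ₗ tangentMapAt EX EM p (i n)) ∘ₗ tangentMapAt G EX i n :=
    LinearMap.ext fun v => congrArg (η : Module.Dual ℝ EM) (hT v)
  rw [h1, hi.map_sharp n]
  exact (hp.map_sharp (i n) η).trans (πM.sharp_congr (h n).symm η)

end PoissonStructure

end Coupling

/-! ### The fibre product and its tangent spaces. -/

section FibreProduct

variable {ES : Type*} [NormedAddCommGroup ES] [NormedSpace ℝ ES] [FiniteDimensional ℝ ES]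
  {S : Type*} [TopologicalSpace S] [ChartedSpace ES S] [T2Space S] [IsManifold 𝓘(ℝ, ES) ∞ S]
  {EM : Type*} [NormedAddCommGroup EM] [NormedSpace ℝ EM] [FiniteDimensional ℝ EM]
  {M : Type*} [TopologicalSpace M] [ChartedSpace EM M] [T2Space M] [IsManifold 𝓘(ℝ, EM) ∞ M]
  {EX : Type*} [NormedAddCommGroup EX] [NormedSpace ℝ EX] [FiniteDimensional ℝ EX]
  {X : Type*} [TopologicalSpace X] [ChartedSpace EX X] [T2Space X] [IsManifold 𝓘(ℝ, EX) ∞ X]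

/-- The dimension of the preimage of a subspace under a surjective linear map. -/
theorem finrank_comap_range_add {T T' T'' : Type*} [AddCommGroup T] [Module ℝ T]
    [AddCommGroup T'] [Module ℝ T'] [AddCommGroup T''] [Module ℝ T''] [FiniteDimensional ℝ T]
    {A : T →ₗ[ℝ] T'} {B : T'' →ₗ[ℝ] T'} (hA : Function.Surjective A)
    (hB : Function.Injective B) :
    Module.finrank ℝ (B.range.comap A) + Module.finrank ℝ T' =
      Module.finrank ℝ T'' + Module.finrank ℝ T := by
  have h1 := LinearMap.finrank_range_add_finrank_ker (A.domRestrict (B.range.comap A))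
  have h2 := LinearMap.finrank_range_add_finrank_ker A
  have h3 : (A.domRestrict (B.range.comap A)).range = B.range := by
    rw [LinearMap.range_domRestrict, Submodule.map_comap_eq_of_surjective hA]
  have h4 : Module.finrank ℝ (A.domRestrict (B.range.comap A)).ker = Module.finrank ℝ A.ker := by
    rw [LinearMap.ker_domRestrict]
    refine (Submodule.comapSubtypeEquivOfLe fun v hv => ?_).finrank_eq
    rw [Submodule.mem_comap, LinearMap.mem_ker.1 hv]
    exact zero_mem _
  rw [h3, h4, LinearMap.finrank_range_of_inj hB] at h1
  rw [LinearMap.range_eq_top.2 hA, finrank_top] at h2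
  omega

/-- The fibre product of an injective immersion and a submersion is a manifold, immersed by the
second projection, whose tangent spaces are the fibre products of the tangent spaces. -/
theorem exists_isManifold_pullback {j : S → M} {p : X → M} (hj : ContMDiff 𝓘(ℝ, ES) 𝓘(ℝ, EM) ∞ j)
    (hinj : ∀ s, Function.Injective (tangentMapAt ES EM j s))
    (hp : ContMDiff 𝓘(ℝ, EX) 𝓘(ℝ, EM) ∞ p)
    (hsurj : ∀ z, Function.Surjective (tangentMapAt EX EM p z)) {k : ℕ}
    (hk : k + Module.finrank ℝ EM = Module.finrank ℝ ES + Module.finrank ℝ EX) :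
    ∃ (_ : ChartedSpace (EuclideanSpace ℝ (Fin k)) (Function.Pullback j p))
      (_ : IsManifold 𝓘(ℝ, EuclideanSpace ℝ (Fin k)) ∞ (Function.Pullback j p)),
      ContMDiff 𝓘(ℝ, EuclideanSpace ℝ (Fin k)) 𝓘(ℝ, ES) ∞
        (Function.Pullback.fst : Function.Pullback j p → S) ∧
      ContMDiff 𝓘(ℝ, EuclideanSpace ℝ (Fin k)) 𝓘(ℝ, EX) ∞
        (Function.Pullback.snd : Function.Pullback j p → X) ∧
      (∀ q : Function.Pullback j p, Function.Injective
        (tangentMapAt (EuclideanSpace ℝ (Fin k)) EX Function.Pullback.snd q)) ∧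
      ∀ (q : Function.Pullback j p) (u : TangentSpace 𝓘(ℝ, ES) q.fst)
        (v : TangentSpace 𝓘(ℝ, EX) q.snd),
        (tangentMapAt ES EM j q.fst u : EM) = tangentMapAt EX EM p q.snd v →
        v ∈ (tangentMapAt (EuclideanSpace ℝ (Fin k)) EX Function.Pullback.snd q).range := by
  obtain ⟨cs, ms, hval, hvinj⟩ := exists_isManifold_of_slices
    (P := fun q : S × X => j q.1 = p q.2) (exists_pullback_chart hj hp hsurj hk)
  have hf : ContMDiff 𝓘(ℝ, EuclideanSpace ℝ (Fin k)) 𝓘(ℝ, ES) ∞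
      (Function.Pullback.fst : Function.Pullback j p → S) := contMDiff_fst.comp hval
  have hs : ContMDiff 𝓘(ℝ, EuclideanSpace ℝ (Fin k)) 𝓘(ℝ, EX) ∞
      (Function.Pullback.snd : Function.Pullback j p → X) := contMDiff_snd.comp hval
  have hT := fun q => PoissonStructure.tangentMapAt_apply_eq_of_comp_eq hf hj hs hp
    (fun q : Function.Pullback j p => q.2) q
  have hsinj : ∀ q : Function.Pullback j p, Function.Injective
      (tangentMapAt (EuclideanSpace ℝ (Fin k)) EX Function.Pullback.snd q) := by
    intro q
    rw [injective_iff_map_eq_zero]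
    intro w hw
    have h1 : tangentMapAt (EuclideanSpace ℝ (Fin k)) ES
        (Function.Pullback.fst : Function.Pullback j p → S) q w = 0 := by
      apply hinj q.fst
      rw [map_zero]
      refine (hT q w).trans ?_
      rw [hw]
      exact map_zero _
    have h2 := mfderiv_comp q (mdifferentiableAt_fst (I := 𝓘(ℝ, ES)) (I' := 𝓘(ℝ, EX)))
      (hval.mdifferentiable (by simp) q)
    have h3 := mfderiv_comp q (mdifferentiableAt_snd (I := 𝓘(ℝ, ES)) (I' := 𝓘(ℝ, EX)))
      (hval.mdifferentiable (by simp) q)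
    rw [mfderiv_fst] at h2
    rw [mfderiv_snd] at h3
    have h4 := congrArg (fun A : EuclideanSpace ℝ (Fin k) →L[ℝ] ES => A w) h2
    have h5 := congrArg (fun A : EuclideanSpace ℝ (Fin k) →L[ℝ] EX => A w) h3
    apply hvinj q
    rw [map_zero]
    exact Prod.ext (h4.symm.trans h1) (h5.symm.trans hw)
  refine ⟨cs, ms, hf, hs, hsinj, fun q u v huv => ?_⟩
  let B : ES →ₗ[ℝ] EM := tangentMapAt ES EM j q.fst
  let A : EX →ₗ[ℝ] EM := tangentMapAt EX EM p q.snd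
  let C : EuclideanSpace ℝ (Fin k) →ₗ[ℝ] EX := tangentMapAt _ EX Function.Pullback.snd q
  have h1 : C.range ≤ B.range.comap A := by
    rintro _ ⟨w, rfl⟩
    exact ⟨_, hT q w⟩
  -- One inclusion comes from differentiating `j ∘ fst = p ∘ snd`; equality follows since both sides
  -- have dimension `k`.
  have h2 : C.range = B.range.comap A := by
    refine Submodule.eq_of_le_of_finrank_eq h1 ?_
    have h3 := finrank_comap_range_add (A := A) (B := B) (hsurj q.snd) (hinj q.fst)
    rw [LinearMap.finrank_range_of_inj (f := C) (hsinj q), finrank_euclideanSpace_fin]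
    omega
  have h3 : (v : EX) ∈ B.range.comap A := ⟨u, huv⟩
  rw [← h2] at h3
  exact h3

end FibreProduct

end SymplecticLeaves

/-! ### Assembly of the theorem. -/

theorem mainTheorem2
    {EX : Type*} [NormedAddCommGroup EX] [NormedSpace ℝ EX] [FiniteDimensional ℝ EX]
    {X : Type*} [TopologicalSpace X] [T2Space X] [SecondCountableTopology X]
    [ChartedSpace EX X] [IsManifold 𝓘(ℝ, EX) ∞ X]
    {EM : Type*} [NormedAddCommGroup EM] [NormedSpace ℝ EM] [FiniteDimensional ℝ EM]
    {M : Type*} [TopologicalSpace M] [T2Space M] [SecondCountableTopology M]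
    [ChartedSpace EM M] [IsManifold 𝓘(ℝ, EM) ∞ M]
    (πX : PoissonStructure EX X) (πM : PoissonStructure EM M)
    (p : X → M) (hp : πX.IsCoregularPoissonSubmersion πM p) (x : X)
    -- the symplectic leaf of `M` through `p x`, included by `j`
    {ES : Type*} [NormedAddCommGroup ES] [NormedSpace ℝ ES] [FiniteDimensional ℝ ES]
    {S : Type*} [TopologicalSpace S] [T2Space S] [SecondCountableTopology S]
    [ChartedSpace ES S] [IsManifold 𝓘(ℝ, ES) ∞ S]
    (πS : PoissonStructure ES S) (j : S → M) (hS : πM.IsSymplecticLeaf (p x) πS j) :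
    -- the preimage of the leaf, as the fibre product `S ×_M X` with its subspace topology
    (range (Function.Pullback.snd : Function.Pullback j p → X) =
        p ⁻¹' πM.hamiltonianOrbit (p x) ∧
      ∃ (k : ℕ) (_ : ChartedSpace (EuclideanSpace ℝ (Fin k)) (Function.Pullback j p))
        (_ : IsManifold 𝓘(ℝ, EuclideanSpace ℝ (Fin k)) ∞ (Function.Pullback j p))
        (πP : PoissonStructure (EuclideanSpace ℝ (Fin k)) (Function.Pullback j p)),
        πP.IsPoissonSubmanifold πX Function.Pullback.snd ∧
        πP.IsCouplingPoissonSubmersion πS Function.Pullback.fst ∧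
        (Function.Surjective p →
          Function.Surjective (Function.Pullback.fst : Function.Pullback j p → S))) ∧
    -- the symplectic leaf of the total space through `x`, included by `i`
    ∀ {EL : Type*} [NormedAddCommGroup EL] [NormedSpace ℝ EL] [FiniteDimensional ℝ EL]
      {L : Type*} [TopologicalSpace L] [T2Space L] [SecondCountableTopology L]
      [ChartedSpace EL L] [IsManifold 𝓘(ℝ, EL) ∞ L]
      (πL : PoissonStructure EL L) (i : L → X), πX.IsSymplecticLeaf x πL i →
      ∃ q : L → S, (∀ l : L, j (q l) = p (i l)) ∧ πL.IsCouplingPoissonSubmersion πS q := by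
  have hjr : ∀ s, (πM.sharp (j s)).range = (tangentMapAt ES EM j s).range := fun s =>
    range_sharp_eq_range_of_injective (hS.symplectic s).2 (hS.map_sharp s)
      (hS.injective_tangentMap s)
  refine ⟨⟨?_, ?_⟩, ?_⟩
  · rw [← hS.range_eq]
    ext z
    constructor
    · rintro ⟨q, rfl⟩
      exact ⟨q.fst, q.2⟩
    · rintro ⟨s, hs⟩
      exact ⟨⟨(s, z), hs⟩, rfl⟩
  · have hle : Module.finrank ℝ EM ≤ Module.finrank ℝ EX :=
      LinearMap.finrank_le_finrank_of_surjective (hp.surjective_tangentMap x)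
    obtain ⟨cs, ms, hf, hs, hsinj, hsr⟩ := exists_isManifold_pullback hS.contMDiff
      hS.injective_tangentMap hp.contMDiff hp.surjective_tangentMap
      -- By `hle`, from surjectivity of `p_*` at `x`, the natural-number subtraction is not
      -- truncated.
      (k := Module.finrank ℝ ES + Module.finrank ℝ EX - Module.finrank ℝ EM) (by omega)
    -- Tangency of `π_X`: `p_*` sends `im π_X^♯` into `im π_M^♯`, which is the tangent space of the
    -- leaf, so `im π_X^♯` lies in the tangent space of the fibre product.
    obtain ⟨πP, hπP⟩ := πX.exists_restriction hs hsinj (by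
      rintro q _ ⟨ξ, rfl⟩
      have h1 := hp.tangentMapAt_sharp_mem q.snd ξ
      obtain ⟨η, hη⟩ := h1
      obtain ⟨u, hu⟩ : (πM.sharp (j q.fst) η) ∈ (tangentMapAt ES EM j q.fst).range :=
        hjr q.fst ▸ ⟨η, rfl⟩
      exact hsr q u _ ((hu.trans (πM.sharp_congr q.2 η)).trans hη))
    refine ⟨_, cs, ms, πP, ⟨hπP, ?_, hsinj⟩, ?_, fun h s => ?_⟩
    · rintro ⟨⟨s, z⟩, h⟩ ⟨⟨s', z'⟩, h'⟩ (rfl : z = z')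
      obtain rfl := hS.injective (h.trans h'.symm)
      rfl
    · exact (hπP.of_comp_eq hf hp.toIsPoissonMap hS.toIsPoissonMap
        hS.injective_tangentMap fun q => q.2).isCouplingPoissonSubmersion hS.symplectic
    · obtain ⟨z, hz⟩ := h (j s)
      exact ⟨⟨(s, z), hz.symm⟩, rfl⟩
  · intro EL _ _ _ L _ _ _ _ _ πL i hL
    obtain ⟨q, hq, hqs⟩ := exists_contMDiff_lift πM hS.contMDiff hS.injective
      hS.injective_tangentMap hjr (hp.contMDiff.comp hL.contMDiff) (fun l => by
        rw [hS.range_eq]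
        exact PoissonStructure.mapsTo_hamiltonianOrbit hp.contMDiff hp.surjective_tangentMap
          hp.tangentMapAt_sharp_mem x (hL.range_eq ▸ mem_range_self l)) (fun l v => by
        rw [PoissonStructure.tangentMapAt_comp hp.contMDiff hL.contMDiff]
        have h1 : tangentMapAt EL EX i l v ∈ (πX.sharp (i l)).range := by
          rw [range_sharp_eq_range_of_injective (hL.symplectic l).2 (hL.map_sharp l)
            (hL.injective_tangentMap l)]
          exact ⟨v, rfl⟩
        obtain ⟨ξ, hξ⟩ := h1
        rw [← hξ]
        exact hp.tangentMapAt_sharp_mem (i l) ξ)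
    exact ⟨q, hq, (hL.toIsPoissonMap.of_comp_eq hqs hp.toIsPoissonMap hS.toIsPoissonMap
      hS.injective_tangentMap hq).isCouplingPoissonSubmersion hS.symplectic⟩
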